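/- Let $\mathfrak g$ be the Lie algebra of a compact simple gauge group, with a basis $(e_{\mathsf a})$, $[e_{\mathsf a},e_{\mathsf b}]=f^{\mathsf{abc}}e_{\mathsf c}$, orthogonal for the Killing form with $\kappa(e_{\mathsf a},e_{\mathsf b})=-C\,\delta_{\mathsf{ab}}$, $C>0$ (equivalently $f^{\mathsf{acd}}f^{\mathsf{bcd}}=C\delta^{\mathsf{ab}}$ with $f$ totally antisymmetric). Let $\eta=\mathrm{diag}(1,-1,\dots,-1)$ be the Minkowski metric on $\mathbb R^d$, let $A_\mu^{\mathsf a}$ (the background gauge potential) and $a_\mu^{\mathsf a}$ (the perturbation) be smooth functions on $\mathbb R^d$, real- or complex-valued; $A$ may be any background, in particular any solution of the Yang–Mills equations. Write $$D_\mu u^{\mathsf a}=\partial_\mu u^{\mathsf a}+f^{\mathsf{abc}}A_\mu^{\mathsf b}u^{\mathsf c},\qquad F^{\mathsf a}_{\mu\nu}=\partial_\mu A^{\mathsf a}_\nu-\partial_\nu A^{\mathsf a}_\mu+f^{\mathsf{abc}}A^{\mathsf b}_\mu A^{\mathsf c}_\nu .$$ The heterotic ambitwistor string on this background is the free chiral worldsheet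 CFT of the bosonic fields $X^\mu,\Pi_\mu$, the fermions $\psi^\mu$, a current algebra $j^{\mathsf a}$ of $\mathfrak g$ at level $0$, the fermionic ghosts $(c,b)$, $(\bar c,\bar b)$ and the bosonic ghosts $(\gamma,\beta)$, with OPEs $$X^\mu(z)\Pi_\nu(w)\sim\frac{\delta^\mu_\nu}{z-w},\quad \psi^\mu(z)\psi^\nu(w)\sim\frac{\eta^{\mu\nu}}{z-w},\quad j^{\mathsf a}(z)j^{\mathsf b}(w)\sim\frac{f^{\mathsf{abc}}j^{\mathsf c}(w)}{z-w},$$ $$c(z)b(w)\sim\bar c(z)\bar b(w)\sim\gamma(z)\beta(w)\sim\frac1{z-w}.$$ Its currents, normal ordered by point splitting, are $\mathsf G=\psi^\mu(\Pi_\mu-A^{\mathsf a}_\mu j^{\mathsf a})$ and $$\mathsf H=\Pi^2-2\Pi^\mu A^{\mathsf a}_\mu j^{\mathsf a}+A^{\mathsf a}_\mu A^{\mu\mathsf b}j^{\mathsf a}j^{\mathsf b}+\psi^\mu\psi^\nu F^{\mathsf a}_{\mu\nu}j^{\mathsf a}-\partial(\partial_\mu A^{\mu\mathsf a}j^{\mathsf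 a})+f^{\mathsf{abc}}j^{\mathsf c}A^{\mu\mathsf b}\partial A^{\mathsf a}_\mu ,$$ and the BRST operator is $$Q=\oint c\,T+bc\,\partial c+\gamma\,\mathsf G+\bar c\,\mathsf H-\tfrac12\,\bar b\,\gamma^2 ,$$ where $T=-\Pi_\mu\partial X^\mu-\tfrac12\psi_\mu\partial\psi^\mu-\tfrac1C j^{\mathsf a}j^{\mathsf a}+\bar c\,\partial\bar b-2\bar b\,\partial\bar c-\tfrac32\beta\,\partial\gamma-\tfrac12\gamma\,\partial\beta$ is the stress tensor of all fields except $(b,c)$. These act on the Neveu–Schwarz states of picture number $-1$: the Fock space over the vacuum $\delta(\gamma)$, with smooth functions of $X$ as wave functions, tensored with the level-$0$ vacuum module of the current algebra. For the fixed gluon vertex operator $V=c\,\bar c\,\delta(\gamma)\,\psi^\mu a^{\mathsf a}_\mu j^{\mathsf a}$ one has $$QV=c\,\bar c\,\delta(\gamma)\,j^{\mathsf a}\Big[\partial\bar c\,\psi^\nu\big(D^\mu D_\mu a^{\mathsf a}_\nu+2f^{\mathsf{abc}}a^{\mathsf b\mu}F^{\mathsf c}_{\mu\nu}\big)-\partial\gamma\,D^\mu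 a^{\mathsf a}_\mu\Big].$$ Consequently $QV=0$ if and only if $a$ satisfies both the Lorenz gauge condition $D^\mu a^{\mathsf a}_\mu=0$ and the linearised Yang–Mills equation $D^\mu D_\mu a^{\mathsf a}_\nu+2f^{\mathsf{abc}}a^{\mathsf b\mu}F^{\mathsf c}_{\mu\nu}=0$, for all $\mathsf a$ and $\nu$. -/

import Mathlib

open scoped TensorProduct ContDiff

noncomputable section

namespace Ambitwistor

/-! ### Minkowski space and smooth functions on it -/

/-- The diagonal entries of the Minkowski metric `diag(1, -1, …, -1)` on `ℝ^d`.  The metric is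
diagonal and equal to its own inverse, so an index is raised or lowered by multiplication by
`eta μ`. -/
def eta {d : ℕ} (μ : Fin d) : ℂ := if (μ : ℕ) = 0 then 1 else -1

/-- Smooth complex-valued functions on `ℝ^d`. -/
def smoothFn (d : ℕ) : Subalgebra ℂ ((Fin d → ℝ) → ℂ) where
  carrier := {f | ContDiff ℝ ∞ f}
  mul_mem' {f g} (hf : ContDiff ℝ ∞ f) (hg : ContDiff ℝ ∞ g) :=
    show ContDiff ℝ ∞ (f * g) from hf.mul hg
  add_mem' {f g} (hf : ContDiff ℝ ∞ f) (hg : ContDiff ℝ ∞ g) :=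
    show ContDiff ℝ ∞ (f + g) from hf.add hg
  algebraMap_mem' c := show ContDiff ℝ ∞ (fun _ : Fin d → ℝ => c) from contDiff_const

abbrev SmoothFn (d : ℕ) : Type := smoothFn d

theorem SmoothFn.contDiff {d : ℕ} (f : SmoothFn d) : ContDiff ℝ ∞ f.1 := f.2

theorem SmoothFn.differentiable {d : ℕ} (f : SmoothFn d) : Differentiable ℝ f.1 :=
  f.contDiff.differentiable (by simp)

/-- The coordinate function `x^μ`. -/
def coordFn {d : ℕ} (μ : Fin d) : SmoothFn d :=
  ⟨fun x => (x μ : ℂ),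
    show ContDiff ℝ ∞ (fun x : Fin d → ℝ => (x μ : ℂ)) from
      Complex.ofRealCLM.contDiff.comp (contDiff_apply ℝ ℝ μ)⟩

/-- The partial derivative `∂_μ`. -/
def pd {d : ℕ} (μ : Fin d) : SmoothFn d →ₗ[ℂ] SmoothFn d where
  toFun f := ⟨fun x => fderiv ℝ f.1 x (Pi.single μ 1),
    show ContDiff ℝ ∞ (fun x => fderiv ℝ f.1 x (Pi.single μ 1)) from
      (f.contDiff.fderiv_right (m := ∞) (by simp)).clm_apply contDiff_const⟩
  map_add' f g := by
    apply Subtype.ext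
    funext x
    change fderiv ℝ (f.1 + g.1) x (Pi.single μ 1) = _
    rw [fderiv_add (f.differentiable x) (g.differentiable x)]
    rfl
  map_smul' c f := by
    apply Subtype.ext
    funext x
    change fderiv ℝ (c • f.1) x (Pi.single μ 1) = _
    rw [fderiv_const_smul (f.differentiable x)]
    rfl

/-! ### Yang–Mills theory in components -/

section YangMills

variable {𝔤 ι : Type*} [LieRing 𝔤] [LieAlgebra ℝ 𝔤] [Fintype ι]

/-- The structure constants `f^{abc}`, defined by `[e_a, e_b] = ∑_c f^{abc} e_c`. -/
def structConst (e : Module.Basis ι ℝ 𝔤) (a b c : ι) : ℂ := ((e.repr ⁅e a, e b⁆ c : ℝ) : ℂ)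

/-- The gauge-covariant derivative `D_μ u^a = ∂_μ u^a + f^{abc} A_μ^b u^c` of an adjoint-valued
function `u`, for the gauge potential `A`. -/
def covD (e : Module.Basis ι ℝ 𝔤) {d : ℕ} (A : Fin d → ι → SmoothFn d) (μ : Fin d)
    (u : ι → SmoothFn d) : ι → SmoothFn d :=
  fun a => pd μ (u a) + ∑ b, ∑ c, structConst e a b c • (A μ b * u c)

/-- The field strength `F_{μν}^a = ∂_μ A_ν^a - ∂_ν A_μ^a + f^{abc} A_μ^b A_ν^c`. -/
def fieldStrength (e : Module.Basis ι ℝ 𝔤) {d : ℕ} (A : Fin d → ι → SmoothFn d) (μ ν : Fin d) :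
    ι → SmoothFn d :=
  fun a => pd μ (A ν a) - pd ν (A μ a) + ∑ b, ∑ c, structConst e a b c • (A μ b * A ν c)

/-- The divergence `D^μ a_μ^a` of a perturbation `a_μ^a`. -/
def lorenz (e : Module.Basis ι ℝ 𝔤) {d : ℕ} (A a : Fin d → ι → SmoothFn d) : ι → SmoothFn d :=
  ∑ μ, eta μ • covD e A μ (a μ)

/-- The linearised Yang–Mills operator
`D^μ D_μ a_ν^a + 2 f^{abc} a^{b μ} F_{μν}^c`. -/
def linYM (e : Module.Basis ι ℝ 𝔤) {d : ℕ} (A a : Fin d → ι → SmoothFn d) (ν : Fin d) :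
    ι → SmoothFn d :=
  fun i => ∑ μ, eta μ • covD e A μ (covD e A μ (a ν)) i +
    (2 : ℂ) • ∑ b, ∑ c, structConst e i b c • ∑ μ, eta μ • (a μ b * fieldStrength e A μ ν c)

end YangMills

/-! ### The state space

Modes of every field `Φ` are numbered by `Φ(z) = ∑_n Φ_(n) z^{-n-1}`, whatever its conformal
weight.  With this numbering an OPE `Φ(z) Ψ(w) ∼ 1 / (z - w)` of free fields reads
`[Φ_(m), Ψ_(n)} = δ_{m+n,-1}`, and a current algebra at level zero reads
`[j^a_(m), j^b_(n)] = f^{abc} j^c_(m+n)`.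

The sector in question is the one with picture number `-1` of the Neveu–Schwarz sector: its vacuum
`|δ(γ)⟩` is the state of the operator `δ(γ)`.  It is annihilated by `γ_(n)` for `n ≥ -1` (since
`γ(z) δ(γ)(0) = O(z)`), by `β_(n)` for `n ≥ 1` (since `β(z) δ(γ)(0) = O(1/z)`), and by the modes
`n ≥ 0` of all other fields. -/

/-- The bosonic creation modes other than the zero mode of `X`: `x μ k` is `X^μ_(-k-2)`, `p μ k` is
`Π_{μ (-k-1)}`, `γ k` is `γ_(-k-2)` and `β k` is `β_(-k)`. -/
inductive BMode (d : ℕ) : Type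
  | x (μ : Fin d) (k : ℕ)
  | p (μ : Fin d) (k : ℕ)
  | γ (k : ℕ)
  | β (k : ℕ)

/-- The fermionic creation modes: `ψ μ k` is `ψ^μ_(-k-1)`, and `c k`, `b k`, `cbar k`, `bbar k` are
the modes `(-k-1)` of the ghosts `c`, `b`, `c̄`, `b̄`. -/
inductive FMode (d : ℕ) : Type
  | ψ (μ : Fin d) (k : ℕ)
  | c (k : ℕ)
  | b (k : ℕ)
  | cbar (k : ℕ)
  | bbar (k : ℕ)

/-- Polynomials in the bosonic creation modes. -/
abbrev Bos (d : ℕ) : Type := MvPolynomial (BMode d) ℂ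

/-- Exterior algebra on the fermionic creation modes. -/
abbrev Fer (d : ℕ) : Type := ExteriorAlgebra ℂ (FMode d →₀ ℂ)

section States

variable (𝔤 : Type*) [LieRing 𝔤] [LieAlgebra ℝ 𝔤]

/-- The loop algebra `𝔤_ℂ ⊗ ℂ[t, t⁻¹]` of the complexification of `𝔤`. -/
abbrev Loop : Type _ := LieAlgebra.loopAlgebra ℂ ℤ (ℂ ⊗[ℝ] 𝔤)

variable {𝔤} in
/-- The element `x t^n` of the loop algebra. -/
def loopElt (x : 𝔤) (n : ℤ) : Loop 𝔤 := AddMonoidAlgebra.single n 1 ⊗ₜ[ℂ] ((1 : ℂ) ⊗ₜ[ℝ] x)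

abbrev LoopU : Type _ := UniversalEnvelopingAlgebra ℂ (Loop 𝔤)

/-- The left ideal generated by the modes `x t^n` with `n ≥ 0`. -/
def annihIdeal : Submodule (LoopU 𝔤) (LoopU 𝔤) :=
  Submodule.span (LoopU 𝔤)
    {u | ∃ (x : 𝔤) (n : ℕ), u = UniversalEnvelopingAlgebra.ι ℂ (loopElt x (n : ℤ))}

/-- The state space of the current algebra at level zero: the vacuum module, generated by a vector
that is annihilated by all `j_(n)` with `n ≥ 0`, with no other relations than the current algebra
`[j^a_(m), j^b_(n)] = f^{abc} j^c_(m+n)`. -/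
def Cur : Type _ := LoopU 𝔤 ⧸ annihIdeal 𝔤

instance : AddCommGroup (Cur 𝔤) := inferInstanceAs (AddCommGroup (LoopU 𝔤 ⧸ annihIdeal 𝔤))

instance : Module (LoopU 𝔤) (Cur 𝔤) := inferInstanceAs (Module (LoopU 𝔤) (LoopU 𝔤 ⧸ annihIdeal 𝔤))

instance : Module ℂ (Cur 𝔤) := inferInstanceAs (Module ℂ (LoopU 𝔤 ⧸ annihIdeal 𝔤))

instance : IsScalarTower ℂ (LoopU 𝔤) (Cur 𝔤) :=
  inferInstanceAs (IsScalarTower ℂ (LoopU 𝔤) (LoopU 𝔤 ⧸ annihIdeal 𝔤))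

/-- The vacuum vector of the current algebra. -/
def curVac : Cur 𝔤 := (Submodule.Quotient.mk 1 : LoopU 𝔤 ⧸ annihIdeal 𝔤)

/-- The state space: smooth functions of the zero mode of `X`, times the Fock spaces of the other
modes, times the vacuum module of the current algebra. -/
abbrev State (d : ℕ) : Type _ := SmoothFn d ⊗[ℂ] (Bos d ⊗[ℂ] (Fer d ⊗[ℂ] Cur 𝔤))

instance (d : ℕ) : AddCommGroup (State 𝔤 d) := TensorProduct.addCommGroup

instance (d : ℕ) : Module ℂ (State 𝔤 d) := TensorProduct.leftModule

/-- The state of the operator `f(X) δ(γ)`. -/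
def fnState {d : ℕ} (f : SmoothFn d) : State 𝔤 d :=
  f ⊗ₜ[ℂ] ((1 : Bos d) ⊗ₜ[ℂ] ((1 : Fer d) ⊗ₜ[ℂ] curVac 𝔤))

/-- A field `Φ(z) = ∑_n Φ_(n) z^{-n-1}`, given by its modes. -/
abbrev WField (d : ℕ) : Type _ := ℤ → State 𝔤 d → State 𝔤 d

variable {𝔤} {d : ℕ}

/-! ### The operations on fields -/

/-- The worldsheet derivative `∂Φ`. -/
def del (Φ : WField 𝔤 d) : WField 𝔤 d := fun n v => (-(n : ℂ)) • Φ (n - 1) v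

/-- The point-splitting normal ordered product of `Φ` and `Ψ`, with sign `s = -1` if both are
fermionic and `s = 1` otherwise:
`(ΦΨ)_(n) = ∑_{m<0} Φ_(m) Ψ_(n-m-1) + s ∑_{m≥0} Ψ_(n-m-1) Φ_(m)`.
On each state only finitely many terms are nonzero. -/
def nopSign (s : ℂ) (Φ Ψ : WField 𝔤 d) : WField 𝔤 d := fun n v =>
  ∑ᶠ m : ℤ, if m < 0 then Φ m (Ψ (n - m - 1) v) else s • Ψ (n - m - 1) (Φ m v)

/-- Normal ordered product of two fields at least one of which is bosonic. -/
def nop (Φ Ψ : WField 𝔤 d) : WField 𝔤 d := nopSign 1 Φ Ψ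

/-- Normal ordered product of two fermionic fields. -/
def nopF (Φ Ψ : WField 𝔤 d) : WField 𝔤 d := nopSign (-1) Φ Ψ

/-! ### The elementary fields -/

def onFn (T : Module.End ℂ (SmoothFn d)) : Module.End ℂ (State 𝔤 d) :=
  LinearMap.rTensor _ T

def onBos (T : Module.End ℂ (Bos d)) : Module.End ℂ (State 𝔤 d) :=
  LinearMap.lTensor _ (LinearMap.rTensor _ T)

def onFer (T : Module.End ℂ (Fer d)) : Module.End ℂ (State 𝔤 d) :=
  LinearMap.lTensor _ (LinearMap.lTensor _ (LinearMap.rTensor _ T))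

def onCur (T : Module.End ℂ (Cur 𝔤)) : Module.End ℂ (State 𝔤 d) :=
  LinearMap.lTensor _ (LinearMap.lTensor _ (LinearMap.lTensor _ T))

/-- Multiplication by a smooth function of the zero mode of `X`. -/
def mulFn (f : SmoothFn d) : Module.End ℂ (State 𝔤 d) := onFn (LinearMap.mulLeft ℂ f)

/-- Multiplication by a bosonic creation mode. -/
def bCre (i : BMode d) : Module.End ℂ (State 𝔤 d) :=
  onBos (LinearMap.mulLeft ℂ (MvPolynomial.X i))

/-- Derivative with respect to a bosonic creation mode. -/
def bAnn (i : BMode d) : Module.End ℂ (State 𝔤 d) :=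
  onBos (MvPolynomial.pderiv i).toLinearMap

/-- Exterior multiplication by a fermionic creation mode. -/
def fCre (i : FMode d) : Module.End ℂ (State 𝔤 d) :=
  onFer (LinearMap.mulLeft ℂ (ExteriorAlgebra.ι ℂ (Finsupp.single i 1)))

/-- Contraction with (the dual of) a fermionic creation mode. -/
def fAnn (i : FMode d) : Module.End ℂ (State 𝔤 d) :=
  onFer (CliffordAlgebra.contractLeft (Q := (0 : QuadraticForm ℂ (FMode d →₀ ℂ)))
    (Finsupp.lapply i))

/-- The modes of `X^μ`. -/
def fX (μ : Fin d) : WField 𝔤 d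
  | Int.negSucc 0, v => mulFn (coordFn μ) v
  | Int.negSucc (k + 1), v => bCre (.x μ k) v
  | Int.ofNat n, v => bAnn (.p μ n) v

/-- The modes of `Π_μ`, with `X^μ(z) Π_ν(w) ∼ δ^μ_ν / (z - w)`. -/
def fPi (μ : Fin d) : WField 𝔤 d
  | Int.negSucc k, v => bCre (.p μ k) v
  | Int.ofNat 0, v => -(onFn (pd μ) v)
  | Int.ofNat (n + 1), v => -(bAnn (.x μ n) v)

/-- The modes of `ψ^μ`, with `ψ^μ(z) ψ^ν(w) ∼ η^{μν} / (z - w)`. -/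
def fPsi (μ : Fin d) : WField 𝔤 d
  | Int.negSucc k, v => fCre (.ψ μ k) v
  | Int.ofNat n, v => eta μ • fAnn (.ψ μ n) v

/-- The modes of `c`, with `c(z) b(w) ∼ 1 / (z - w)`. -/
def fC : WField 𝔤 d
  | Int.negSucc k, v => fCre (.c k) v
  | Int.ofNat n, v => fAnn (.b n) v

/-- The modes of `b`. -/
def fB : WField 𝔤 d
  | Int.negSucc k, v => fCre (.b k) v
  | Int.ofNat n, v => fAnn (.c n) v

/-- The modes of `c̄`, with `c̄(z) b̄(w) ∼ 1 / (z - w)`. -/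
def fCbar : WField 𝔤 d
  | Int.negSucc k, v => fCre (.cbar k) v
  | Int.ofNat n, v => fAnn (.bbar n) v

/-- The modes of `b̄`. -/
def fBbar : WField 𝔤 d
  | Int.negSucc k, v => fCre (.bbar k) v
  | Int.ofNat n, v => fAnn (.cbar n) v

/-- The modes of `γ` in picture number `-1`, with `γ(z) β(w) ∼ 1 / (z - w)`. -/
def fGamma : WField 𝔤 d
  | Int.negSucc 0, v => bAnn (.β 0) v
  | Int.negSucc (k + 1), v => bCre (.γ k) v
  | Int.ofNat n, v => bAnn (.β (n + 1)) v

/-- The modes of `β` in picture number `-1`. -/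
def fBeta : WField 𝔤 d
  | Int.negSucc k, v => bCre (.β (k + 1)) v
  | Int.ofNat 0, v => bCre (.β 0) v
  | Int.ofNat (n + 1), v => -(bAnn (.γ n) v)

/-- The modes of the current `j(x)` for `x` in `𝔤`; the current `j^a` is `fJ (e a)`. -/
def fJ (x : 𝔤) : WField 𝔤 d := fun n v =>
  onCur (Algebra.lsmul ℂ ℂ (Cur 𝔤) (UniversalEnvelopingAlgebra.ι ℂ (loopElt x n))) v

/-- The field `f(X(z))` for a smooth function `f`, by Taylor expansion around the zero mode `x`:
`f(X(z)) = ∑_N (1/N!) ∑_{μ₁,…,μ_N} (∂_{μ₁} ⋯ ∂_{μ_N} f)(x) ξ^{μ₁}(z) ⋯ ξ^{μ_N}(z)`, where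
`ξ^μ(z) = X^μ(z) - x^μ = ∑_{k ≠ -1} X^μ_(k) z^{-k-1}` (all modes of `X` commute).  The list `l`
holds the pairs `(μ_i, k_i)`; the mode `n` collects the terms with `∑_i (-k_i - 1) = -n - 1`.
On each state only finitely many terms are nonzero. -/
def fFn (f : SmoothFn d) : WField 𝔤 d := fun n v =>
  ∑ᶠ l : List (Fin d × ℤ),
    if (∀ q ∈ l, q.2 ≠ -1) ∧ (l.map fun q => -q.2 - 1).sum = -n - 1 then
      ((l.length.factorial : ℂ)⁻¹) •
        mulFn (l.foldr (fun q g => pd q.1 g) f) (l.foldr (fun q w => fX q.1 q.2 w) v)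
    else 0

end States

/-! ### The heterotic ambitwistor string on a gauge background -/

section Model

variable {𝔤 ι : Type*} [LieRing 𝔤] [LieAlgebra ℝ 𝔤] [Fintype ι] (e : Module.Basis ι ℝ 𝔤)
  {d : ℕ}

/-- The current `G = ψ^μ (Π_μ - A_μ^a j^a)`. -/
def curG (A : Fin d → ι → SmoothFn d) : WField 𝔤 d :=
  ∑ μ, nop (fPsi μ) (fPi μ - ∑ a, nop (fFn (A μ a)) (fJ (e a)))

/-- The current
`H = Π² - 2 Π^μ A_μ^a j^a + A_μ^a A^{μ b} j^a j^b + ψ^μ ψ^ν F_{μν}^a j^a - ∂(∂_μ A^{μ a} j^a)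
  + f^{abc} j^c A^{μ b} ∂A_μ^a`. -/
def curH (A : Fin d → ι → SmoothFn d) : WField 𝔤 d :=
  (∑ μ, eta μ • nop (fPi μ) (fPi μ))
  - (2 : ℂ) • (∑ μ, eta μ • ∑ a, nop (fPi μ) (nop (fFn (A μ a)) (fJ (e a))))
  + (∑ μ, eta μ • ∑ a, ∑ b, nop (fFn (A μ a * A μ b)) (nop (fJ (e a)) (fJ (e b))))
  + (∑ μ, ∑ ν, ∑ a,
      nop (nopF (fPsi μ) (fPsi ν)) (nop (fFn (fieldStrength e A μ ν a)) (fJ (e a))))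
  - del (∑ μ, eta μ • ∑ a, nop (fFn (pd μ (A μ a))) (fJ (e a)))
  + ∑ a, ∑ b, ∑ c, structConst e a b c •
      ∑ μ, eta μ • nop (fJ (e c)) (nop (fFn (A μ b)) (del (fFn (A μ a))))

/-- The stress tensor of all fields except `(b, c)`:
`T = -Π_μ ∂X^μ - ½ ψ_μ ∂ψ^μ + T_C + (c̄ ∂b̄ - 2 b̄ ∂c̄) + (-(3/2) β ∂γ - ½ γ ∂β)`.
Here `T_C = -(1/C) j^a j^a` is the Sugawara stress tensor of the current algebra at level zero,
`C` being given by `f^{acd} f^{bcd} = C δ^{ab}`. -/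
def stressT (C : ℝ) : WField 𝔤 d :=
  -(∑ μ, nop (fPi μ) (del (fX μ)))
  - (1 / 2 : ℂ) • (∑ μ, eta μ • nopF (fPsi μ) (del (fPsi μ)))
  - ((C : ℂ)⁻¹) • (∑ a, nop (fJ (e a)) (fJ (e a)))
  + (nopF fCbar (del fBbar) - (2 : ℂ) • nopF fBbar (del fCbar))
  + (-((3 / 2 : ℂ) • nop fBeta (del fGamma)) - (1 / 2 : ℂ) • nop fGamma (del fBeta))

/-- The BRST operator `Q = ∮ c T + b c ∂c + γ G + c̄ H - ½ b̄ γ²` in the gauge background `A`. -/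
def brstQ (C : ℝ) (A : Fin d → ι → SmoothFn d) : State 𝔤 d → State 𝔤 d :=
  (show WField 𝔤 d from nop fC (stressT e C) + nop fB (nopF fC (del fC)) + nop fGamma (curG e A)
    + nop fCbar (curH e A) - (1 / 2 : ℂ) • nop fBbar (nop fGamma fGamma)) 0

/-- The (state of the) fixed gluon vertex operator `V = c c̄ δ(γ) ψ^μ a_μ^a j^a`. -/
def gluonV (a : Fin d → ι → SmoothFn d) : State 𝔤 d :=
  ∑ μ, ∑ i, fC (-1) (fCbar (-1) (fPsi μ (-1) (fJ (e i) (-1) (fnState 𝔤 (a μ i)))))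

end Model

end Ambitwistor

end

/-!
On states without excitations above the lowest mode that can act on them, a normal ordered product
acts through the top modes of its factors alone, so that `Q V` reduces to the top modes of `T`, `G`
and `H`. The Casimir `-1/C j^a j^a`, the number of `ψ` and the ghost `δ(γ)` give `V` conformal
weight `1` under `T`, and `c T` then cancels against `b c ∂c`; the top mode of `G` produces the
Lorenz condition and that of `H` the linearised Yang–Mills operator.

That `Q V = 0` forces both equations needs the states `j^a_(-1)|0⟩` of the level-`0` vacuum module
to be linearly independent. Loops `ξ` act on the group of series `g = 1 + O(t⁻¹)` by the vector
fields `g ↦ g (g⁻¹ ξ g)₊`; that these represent the loop algebra is the Rota–Baxter identity for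
the projection onto one half of the loops. Loops regular at `t = 0` fix the identity, so the vacuum
can be sent to the delta distribution there, and `j^a_(-1)|0⟩` goes to its derivative in the
direction `e_a` of the adjoint representation, which is faithful as the Killing form is
nondegenerate.
-/

noncomputable section

namespace Ambitwistor

section RotaBaxter

/-- The Rota–Baxter identity of weight `-1`: it holds for the projection of a ring onto one of two
complementary subrings along the other one. -/
def IsRotaBaxter {L : Type*} [Ring L] (π : L → L) : Prop :=
  ∀ x y, π x * π y + π (x * y) = π (π x * y + x * π y)

/-- Additive maps that satisfy the Leibniz rule; in contrast to `Derivation`, the ring may be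
noncommutative. -/
def IsLeibniz {L : Type*} [Ring L] (D : L →+ L) : Prop :=
  ∀ x y, D (x * y) = D x * y + x * D y

variable {L : Type*} [Ring L] {π D E : L →+ L} {ξ η : L} (g : Lˣ)

theorem IsLeibniz.conj_eq_lie (hD : IsLeibniz D) (hξ : D ξ = 0)
    (hg : D g = g * π (↑g⁻¹ * η * g)) :
    D (↑g⁻¹ * ξ * g) =
      ↑g⁻¹ * ξ * g * π (↑g⁻¹ * η * g) - π (↑g⁻¹ * η * g) * (↑g⁻¹ * ξ * g) := by
  have h : D (g * (↑g⁻¹ * ξ * g)) = D (ξ * g) := by rw [mul_assoc, Units.mul_inv_cancel_left]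
  rw [hD g, hD ξ, hξ, hg, zero_mul, zero_add, ← eq_sub_iff_add_eq'] at h
  rw [← Units.mul_right_inj g, h, mul_sub]
  simp only [← mul_assoc, Units.mul_inv, one_mul]

/-- The vector fields `g ↦ g (g⁻¹ ξ g)₊` on a group with Lie algebra the image of `π`. -/
theorem IsRotaBaxter.sub_eq_lie (hπ : IsRotaBaxter π) (hD : IsLeibniz D) (hE : IsLeibniz E)
    (hDπ : ∀ x, D (π x) = π (D x)) (hEπ : ∀ x, E (π x) = π (E x)) (hDη : D η = 0) (hEξ : E ξ = 0)
    (hDg : D g = g * π (↑g⁻¹ * ξ * g)) (hEg : E g = g * π (↑g⁻¹ * η * g)) :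
    E (D g) - D (E g) = g * π (↑g⁻¹ * (ξ * η - η * ξ) * g) := by
  have hlie : ↑g⁻¹ * (ξ * η - η * ξ) * g =
      ↑g⁻¹ * ξ * g * (↑g⁻¹ * η * g) - ↑g⁻¹ * η * g * (↑g⁻¹ * ξ * g) := by
    simp only [mul_assoc, Units.mul_inv_cancel_left, mul_sub, sub_mul]
  have hXY := hπ (↑g⁻¹ * ξ * g) (↑g⁻¹ * η * g)
  have hYX := hπ (↑g⁻¹ * η * g) (↑g⁻¹ * ξ * g)
  rw [hDg, hEg, hD, hE, hDπ, hEπ, hD.conj_eq_lie g hDη hDg, hE.conj_eq_lie g hEξ hEg, hDg, hEg,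
    hlie]
  generalize ↑g⁻¹ * ξ * g = x at *
  generalize ↑g⁻¹ * η * g = y at *
  simp only [mul_assoc, ← mul_add, ← mul_sub]
  congr 1
  rw [map_add, ← eq_sub_iff_add_eq] at hXY hYX
  rw [hXY, hYX]
  simp only [map_sub]
  abel

end RotaBaxter

section LoopGroup

open HahnSeries

/-- The strictly positive part of a Laurent series. -/
def posPart (S : Type*) [Ring S] [Algebra ℂ S] : LaurentSeries S →ₗ[ℂ] LaurentSeries S :=
  LinearMap.id - truncLTLinearMap ℂ (1 : ℤ)

section Coefficients

variable {S : Type*} [Ring S]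

/-- Application of an additive map to the coefficients of a Laurent series. -/
def coeffwise (δ : S →+ S) : LaurentSeries S →+ LaurentSeries S where
  toFun f := f.map δ
  map_zero' := by ext; simp
  map_add' f g := by ext; simp

theorem coeff_coeffwise (δ : S →+ S) (f : LaurentSeries S) (n : ℤ) :
    (coeffwise δ f).coeff n = δ (f.coeff n) := rfl

/-- Application of a ring homomorphism to the coefficients of a Laurent series. -/
def coeffwiseRingHom {S' : Type*} [Ring S'] (φ : S →+* S') :
    LaurentSeries S →+* LaurentSeries S' where
  toFun f := f.map φ
  map_one' := HahnSeries.map_one φ.toMonoidWithZeroHom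
  map_mul' _ _ := HahnSeries.map_mul (φ : S →ₙ+* S')
  map_zero' := HahnSeries.map_zero (φ : ZeroHom S S')
  map_add' _ _ := HahnSeries.map_add (φ : S →+ S')

theorem coeffwise_single {δ : S →+ S} {a : S} (ha : δ a = 0) (n : ℤ) :
    coeffwise δ (single n a) = 0 := by
  ext m
  rw [coeff_coeffwise, coeff_single]
  split_ifs <;> simp [ha]

theorem IsLeibniz.coeffwise {δ : S →+ S} (hδ : IsLeibniz δ) : IsLeibniz (coeffwise δ) := by
  intro f g
  ext n
  have hsupp (f : LaurentSeries S) : (Ambitwistor.coeffwise δ f).support ⊆ f.support :=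
    fun m hm h => hm (by rw [coeff_coeffwise, h, map_zero])
  rw [coeff_add, coeff_mul_left' f.isPWO_support (hsupp f),
    coeff_mul_right' g.isPWO_support (hsupp g), coeff_coeffwise, coeff_mul, map_sum,
    ← Finset.sum_add_distrib]
  exact Finset.sum_congr rfl fun _ _ => hδ _ _

variable [Algebra ℂ S]

theorem coeff_posPart (f : LaurentSeries S) (n : ℤ) :
    (posPart S f).coeff n = if 0 < n then f.coeff n else 0 := by
  change f.coeff n - (truncLT 1 f).coeff n = _
  rw [HahnSeries.coeff_truncLT]
  split_ifs <;> first | omega | simp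

theorem coeffwise_posPart (δ : S →+ S) (f : LaurentSeries S) :
    coeffwise δ (posPart S f) = posPart S (coeffwise δ f) := by
  ext n
  simp only [coeff_coeffwise, coeff_posPart, apply_ite δ, map_zero]

theorem posPart_eq_zero_iff {f : LaurentSeries S} :
    posPart S f = 0 ↔ ∀ n, 0 < n → f.coeff n = 0 := by
  simp only [HahnSeries.ext_iff, funext_iff, coeff_posPart, coeff_zero, ite_eq_right_iff]

theorem posPart_eq_self_iff {f : LaurentSeries S} :
    posPart S f = f ↔ ∀ n, n ≤ 0 → f.coeff n = 0 := by
  simp only [HahnSeries.ext_iff, funext_iff, coeff_posPart, ite_eq_left_iff, not_lt]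
  exact forall₂_congr fun _ _ => eq_comm

theorem isRotaBaxter_posPart : IsRotaBaxter (posPart S) := by
  intro f g
  have hneg (f : LaurentSeries S) {n : ℤ} (hn : 0 < n) : (f - posPart S f).coeff n = 0 := by
    rw [coeff_sub, coeff_posPart, if_pos hn, sub_self]
  have hpp : posPart S (posPart S f * posPart S g) = posPart S f * posPart S g := by
    refine posPart_eq_self_iff.mpr fun n hn => ?_
    rw [coeff_mul]
    refine Finset.sum_eq_zero fun ij hij => ?_
    rw [Finset.mem_antidiagonal] at hij
    rw [coeff_posPart, coeff_posPart]
    split_ifs <;> first | omega | simp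
  have hnn : posPart S ((f - posPart S f) * (g - posPart S g)) = 0 := by
    refine posPart_eq_zero_iff.mpr fun n hn => ?_
    rw [coeff_mul]
    refine Finset.sum_eq_zero fun ij hij => ?_
    rw [Finset.mem_antidiagonal] at hij
    rcases lt_or_ge 0 ij.1 with h | h
    · rw [hneg f h, zero_mul]
    · rw [hneg g (by omega), mul_zero]
  rw [sub_mul, mul_sub, mul_sub, map_sub, map_sub, map_sub, hpp] at hnn
  rw [map_add, ← sub_eq_zero, ← hnn]
  abel

end Coefficients

section BigCell

variable (κ : Type*)

/-- Polynomial functions on the group of matrix-valued series `1 + ∑_{m ≥ 0} g_m s^{m+1}`; the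
variable `(m, i, j)` is the matrix entry `(g_m)_{ij}`. -/
abbrev CellRing : Type _ := MvPolynomial (ℕ × κ × κ) ℂ

variable [DecidableEq κ]

/-- The generic power series `1 + ∑_{m ≥ 0} g_m s^{m+1}` over the coordinate ring `CellRing κ`. -/
def genericSeries : PowerSeries (Matrix κ κ (CellRing κ)) :=
  PowerSeries.mk fun
    | 0 => 1
    | m + 1 => Matrix.of fun i j => MvPolynomial.X (m, i, j)

variable [Fintype κ]

/-- The generic element of the group with coordinate ring `CellRing κ`, which is the big cell of the
loop Grassmannian. -/
def genericLoop : (LaurentSeries (Matrix κ κ (CellRing κ)))ˣ :=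
  Units.map (ofPowerSeries ℤ _).toMonoidHom
    ⟨genericSeries κ, (genericSeries κ).invOfUnit 1, PowerSeries.mul_invOfUnit _ _ (by
      simp [genericSeries]), PowerSeries.invOfUnit_mul _ _ (by simp [genericSeries])⟩

variable {κ}

theorem coeff_genericLoop (n : ℤ) : (genericLoop κ).1.coeff n =
    if n < 0 then 0 else PowerSeries.coeff n.natAbs (genericSeries κ) :=
  PowerSeries.coeff_coe _ n

theorem coeff_genericLoop_add_one (m : ℕ) :
    (genericLoop κ).1.coeff (m + 1) = Matrix.of fun i j => MvPolynomial.X (m, i, j) := by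
  rw [coeff_genericLoop, if_neg (by omega), genericSeries, PowerSeries.coeff_mk]
  rfl

theorem coeff_genericLoop_of_nonpos {n : ℤ} (hn : n ≤ 0) :
    (genericLoop κ).1.coeff n = if n = 0 then 1 else 0 := by
  rw [coeff_genericLoop]
  rcases hn.lt_or_eq with hn | rfl
  · rw [if_pos hn, if_neg hn.ne]
  · rw [if_neg (lt_irrefl _), if_pos rfl, genericSeries, PowerSeries.coeff_mk]
    rfl

variable (κ) in
/-- The logarithmic velocity field `ξ ↦ g (g⁻¹ ξ g)₊` on the big cell, at its generic point. -/
def velocity : LaurentSeries (Matrix κ κ (CellRing κ)) →ₗ[ℂ]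
    LaurentSeries (Matrix κ κ (CellRing κ)) where
  toFun ξ := (genericLoop κ).1 * posPart _ ((genericLoop κ)⁻¹.1 * ξ * (genericLoop κ).1)
  map_add' ξ η := by rw [mul_add, add_mul, map_add, mul_add]
  map_smul' c ξ := by
    have mul_smul (x y : LaurentSeries (Matrix κ κ (CellRing κ))) : x * c • y = c • (x * y) :=
      Algebra.mul_smul_comm c x y
    have smul_mul (x y : LaurentSeries (Matrix κ κ (CellRing κ))) : c • x * y = c • (x * y) :=
      Algebra.smul_mul_assoc c x y
    rw [mul_smul, smul_mul, map_smul, mul_smul, RingHom.id_apply]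

theorem velocity_apply (ξ : LaurentSeries (Matrix κ κ (CellRing κ))) :
    velocity κ ξ = (genericLoop κ).1 *
      posPart _ ((genericLoop κ)⁻¹.1 * ξ * (genericLoop κ).1) := rfl

theorem coeff_velocity_of_nonpos (ξ : LaurentSeries (Matrix κ κ (CellRing κ))) {n : ℤ}
    (hn : n ≤ 0) : (velocity κ ξ).coeff n = 0 := by
  rw [velocity_apply, coeff_mul]
  refine Finset.sum_eq_zero fun ij hij => ?_
  rw [Finset.mem_antidiagonal] at hij
  rw [coeff_posPart]
  split_ifs with h
  · rw [coeff_genericLoop_of_nonpos (by omega), if_neg (by omega), zero_mul]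
  · exact mul_zero _

/-- The vector field on the big cell by which the loop `ξ` acts. -/
def vectorField : LaurentSeries (Matrix κ κ (CellRing κ)) →ₗ[ℂ]
    Derivation ℂ (CellRing κ) (CellRing κ) where
  toFun ξ := MvPolynomial.mkDerivation ℂ fun q => (velocity κ ξ).coeff (q.1 + 1) q.2.1 q.2.2
  map_add' ξ η := MvPolynomial.derivation_ext fun q => by simp
  map_smul' c ξ := MvPolynomial.derivation_ext fun q => by simp

theorem vectorField_X (ξ : LaurentSeries (Matrix κ κ (CellRing κ))) (q : ℕ × κ × κ) :
    vectorField ξ (MvPolynomial.X q) = (velocity κ ξ).coeff (q.1 + 1) q.2.1 q.2.2 :=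
  MvPolynomial.mkDerivation_X ..

/-- Entrywise application of a derivation to the coefficients of a matrix-valued Laurent series. -/
def loopDerivation (D : Derivation ℂ (CellRing κ) (CellRing κ)) :
    LaurentSeries (Matrix κ κ (CellRing κ)) →+ LaurentSeries (Matrix κ κ (CellRing κ)) :=
  coeffwise (D : CellRing κ →+ CellRing κ).mapMatrix

theorem coeff_loopDerivation (D : Derivation ℂ (CellRing κ) (CellRing κ))
    (f : LaurentSeries (Matrix κ κ (CellRing κ))) (n : ℤ) (i j : κ) :
    (loopDerivation D f).coeff n i j = D (f.coeff n i j) := rfl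

theorem isLeibniz_loopDerivation (D : Derivation ℂ (CellRing κ) (CellRing κ)) :
    IsLeibniz (loopDerivation D) := by
  refine IsLeibniz.coeffwise fun M N => ?_
  ext i j
  simp [Matrix.mul_apply, Finset.sum_add_distrib, mul_comm, add_comm]

theorem loopDerivation_genericLoop (ξ : LaurentSeries (Matrix κ κ (CellRing κ))) :
    loopDerivation (vectorField ξ) (genericLoop κ).1 = velocity κ ξ := by
  refine HahnSeries.ext (funext fun n => Matrix.ext fun i j => ?_)
  rw [coeff_loopDerivation]
  rcases le_or_gt n 0 with hn | hn
  · rw [coeff_genericLoop_of_nonpos hn, coeff_velocity_of_nonpos ξ hn]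
    split_ifs <;> simp [Matrix.one_apply, apply_ite (vectorField ξ)]
  · obtain ⟨m, rfl⟩ : ∃ m : ℕ, n = m + 1 := ⟨(n - 1).toNat, by omega⟩
    rw [coeff_genericLoop_add_one]
    exact vectorField_X ξ (m, i, j)

/-- Loops that do not depend on the point of the big cell. -/
def IsConstant (ξ : LaurentSeries (Matrix κ κ (CellRing κ))) : Prop :=
  ∀ D, loopDerivation D ξ = 0

theorem vectorField_lie {ξ η : LaurentSeries (Matrix κ κ (CellRing κ))} (hξ : IsConstant ξ)
    (hη : IsConstant η) :
    ⁅vectorField η, vectorField ξ⁆ = vectorField (ξ * η - η * ξ) := by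
  refine MvPolynomial.derivation_ext fun q => ?_
  have h := isRotaBaxter_posPart.sub_eq_lie (genericLoop κ)
    (π := (posPart (Matrix κ κ (CellRing κ))).toAddMonoidHom)
    (isLeibniz_loopDerivation (vectorField ξ)) (isLeibniz_loopDerivation (vectorField η))
    (coeffwise_posPart _) (coeffwise_posPart _) (hη _) (hξ _)
    (loopDerivation_genericLoop ξ) (loopDerivation_genericLoop η)
  rw [loopDerivation_genericLoop, loopDerivation_genericLoop] at h
  have hq := congrArg (fun f => f.coeff (q.1 + 1) q.2.1 q.2.2) h
  rw [Derivation.commutator_apply]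
  rw [vectorField_X, vectorField_X, vectorField_X]
  exact hq

variable (κ) in
/-- Evaluation at the identity of the group. -/
def evalOne : LaurentSeries (Matrix κ κ (CellRing κ)) →+* LaurentSeries (Matrix κ κ ℂ) :=
  coeffwiseRingHom MvPolynomial.constantCoeff.mapMatrix

theorem coeff_evalOne (f : LaurentSeries (Matrix κ κ (CellRing κ))) (n : ℤ) (i j : κ) :
    (evalOne κ f).coeff n i j = MvPolynomial.constantCoeff (f.coeff n i j) := rfl

theorem evalOne_genericLoop : evalOne κ (genericLoop κ).1 = 1 := by
  ext n i j
  rw [coeff_evalOne]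
  rcases le_or_gt n 0 with hn | hn
  · rw [coeff_genericLoop_of_nonpos hn, coeff_one]
    split_ifs <;> simp [Matrix.one_apply, apply_ite MvPolynomial.constantCoeff]
  · obtain ⟨m, rfl⟩ : ∃ m : ℕ, n = m + 1 := ⟨(n - 1).toNat, by omega⟩
    rw [coeff_genericLoop_add_one, coeff_one, if_neg (by omega)]
    exact MvPolynomial.constantCoeff_X (R := ℂ) (m, i, j)

theorem evalOne_velocity (ξ : LaurentSeries (Matrix κ κ (CellRing κ))) :
    evalOne κ (velocity κ ξ) = posPart _ (evalOne κ ξ) := by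
  have hinv : evalOne κ ((genericLoop κ)⁻¹.1 * (genericLoop κ).1) = 1 := by
    rw [Units.inv_mul, map_one]
  rw [map_mul, evalOne_genericLoop, mul_one] at hinv
  have hpos (f : LaurentSeries (Matrix κ κ (CellRing κ))) :
      evalOne κ (posPart _ f) = posPart _ (evalOne κ f) := by
    ext n i j
    rw [coeff_evalOne, coeff_posPart, coeff_posPart]
    split_ifs
    · rfl
    · simp
  rw [velocity_apply, map_mul, hpos, map_mul (evalOne κ) _ (genericLoop κ).1,
    map_mul (evalOne κ) _ ξ, evalOne_genericLoop, hinv, one_mul, one_mul, mul_one]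

theorem constantCoeff_vectorField_X (ξ : LaurentSeries (Matrix κ κ (CellRing κ)))
    (q : ℕ × κ × κ) : MvPolynomial.constantCoeff (vectorField ξ (MvPolynomial.X q)) =
      (evalOne κ ξ).coeff (q.1 + 1) q.2.1 q.2.2 := by
  have h := congrArg (fun f => f.coeff (q.1 + 1) q.2.1 q.2.2) (evalOne_velocity ξ)
  rw [coeff_posPart, if_pos (by omega)] at h
  rw [vectorField_X]
  exact h

end BigCell

end LoopGroup

section LoopRepresentation

open HahnSeries

attribute [local instance 100] LieRing.ofAssociativeRing

variable {𝔤 κ : Type*} [LieRing 𝔤] [LieAlgebra ℝ 𝔤]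

theorem loop_induction {p : Loop 𝔤 → Prop} (add : ∀ X Y, p X → p Y → p (X + Y))
    (single : ∀ n y, p (AddMonoidAlgebra.single n 1 ⊗ₜ[ℂ] y)) (X : Loop 𝔤) : p X := by
  obtain ⟨f, rfl⟩ := (LieAlgebra.LoopAlgebra.toFinsupp ℂ ℤ (ℂ ⊗[ℝ] 𝔤)).symm.surjective X
  induction f using Finsupp.induction_linear with
  | zero => simpa using single 0 0
  | add f g hf hg => rw [map_add]; exact add _ _ hf hg
  | single n y => rw [LieAlgebra.LoopAlgebra.toFinsupp_symm_single]; exact single n y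

variable [DecidableEq κ] [Fintype κ] (ρ : ℂ ⊗[ℝ] 𝔤 →ₗ⁅ℂ⁆ Matrix κ κ ℂ)

/-- The loop algebra in a matrix representation `ρ`, as constant Laurent series on the big cell in
the coordinate `s = t⁻¹`. -/
def loopSeries : Loop 𝔤 →ₗ[ℂ] LaurentSeries (Matrix κ κ (CellRing κ)) :=
  Finsupp.lsum ℂ (fun n : ℤ => single.linearMap (-n) ∘ₗ
    (Algebra.ofId ℂ (CellRing κ)).mapMatrix.toLinearMap ∘ₗ (ρ : ℂ ⊗[ℝ] 𝔤 →ₗ[ℂ] Matrix κ κ ℂ)) ∘ₗ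
    (LieAlgebra.LoopAlgebra.toFinsupp ℂ ℤ (ℂ ⊗[ℝ] 𝔤)).toLinearMap

theorem loopSeries_single (n : ℤ) (y : ℂ ⊗[ℝ] 𝔤) :
    loopSeries ρ (AddMonoidAlgebra.single n 1 ⊗ₜ[ℂ] y) =
      single (-n) ((ρ y).map (algebraMap ℂ (CellRing κ))) := by
  rw [loopSeries, LinearMap.comp_apply, LinearEquiv.coe_coe,
    LieAlgebra.LoopAlgebra.toFinsupp_single_tmul, Finsupp.lsum_single]
  rfl

theorem isConstant_loopSeries (X : Loop 𝔤) : IsConstant (loopSeries ρ X) := by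
  intro D
  induction X using loop_induction with
  | add X Y hX hY => rw [map_add, map_add, hX, hY, add_zero]
  | single n y =>
    rw [loopSeries_single]
    refine coeffwise_single (Matrix.ext fun i j => ?_) _
    exact D.map_algebraMap (ρ y i j)

theorem loopSeries_lie (X Y : Loop 𝔤) :
    loopSeries ρ ⁅X, Y⁆ = loopSeries ρ X * loopSeries ρ Y - loopSeries ρ Y * loopSeries ρ X := by
  induction X using loop_induction with
  | add X X' h h' =>
    rw [show ⁅(X + X' : Loop 𝔤), Y⁆ = ⁅(X : Loop 𝔤), Y⁆ + ⁅(X' : Loop 𝔤), Y⁆ from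
      add_lie (L := Loop 𝔤) X X' Y, map_add, h, h', map_add, add_mul, mul_add]
    abel
  | single n x =>
    induction Y using loop_induction with
    | add Y Y' h h' =>
      rw [show ⁅(AddMonoidAlgebra.single n 1 ⊗ₜ[ℂ] x : Loop 𝔤), (Y + Y' : Loop 𝔤)⁆ =
        ⁅(AddMonoidAlgebra.single n 1 ⊗ₜ[ℂ] x : Loop 𝔤), (Y : Loop 𝔤)⁆ +
          ⁅(AddMonoidAlgebra.single n 1 ⊗ₜ[ℂ] x : Loop 𝔤), (Y' : Loop 𝔤)⁆ from
        lie_add (L := Loop 𝔤) _ Y Y', map_add, h, h', map_add, add_mul, mul_add]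
      abel
    | single m y =>
      rw [LieAlgebra.ExtendScalars.bracket_tmul, AddMonoidAlgebra.single_mul_single, mul_one]
      simp only [loopSeries_single, single_mul_single, LieHom.map_lie,
        LieRing.of_associative_ring_bracket, Matrix.map_sub _ (map_sub _), Matrix.map_mul]
      rw [add_comm (-m), ← neg_add]
      exact map_sub (single.addMonoidHom (-(n + m))) _ _

/-- The representation of the loop algebra on distributions on the big cell. -/
def cellRep : Loop 𝔤 →ₗ⁅ℂ⁆ Module.End ℂ (Module.Dual ℂ (CellRing κ)) where
  toFun X := Module.Dual.transpose (R := ℂ) (vectorField (loopSeries ρ X)).toLinearMap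
  map_add' X Y := by ext φ p; simp
  map_smul' c X := by ext φ p; simp
  map_lie' {X Y} := by
    refine LinearMap.ext fun φ => LinearMap.ext fun p => ?_
    rw [loopSeries_lie, ← vectorField_lie (isConstant_loopSeries ρ X) (isConstant_loopSeries ρ Y)]
    exact φ.map_sub _ _

theorem constantCoeff_derivation {R σ : Type*} [CommRing R]
    (D : Derivation R (MvPolynomial σ R) (MvPolynomial σ R))
    (h : ∀ k, MvPolynomial.constantCoeff (D (MvPolynomial.X k)) = 0) (p : MvPolynomial σ R) :
    MvPolynomial.constantCoeff (D p) = 0 := by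
  induction p using MvPolynomial.induction_on with
  | C a => simp
  | add p q hp hq => rw [map_add, map_add, hp, hq, add_zero]
  | mul_X p k hp => simp [Derivation.leibniz, h, hp]

/-- The delta distribution at the identity of the group. -/
def deltaOne (κ : Type*) : Module.Dual ℂ (CellRing κ) := MvPolynomial.lcoeff ℂ 0

theorem constantCoeff_vectorField_loopElt_X (x : 𝔤) (n : ℤ) (q : ℕ × κ × κ) :
    MvPolynomial.constantCoeff
        (vectorField (loopSeries ρ (loopElt x n)) (MvPolynomial.X q)) =
      if (q.1 + 1 : ℤ) = -n then ρ (1 ⊗ₜ x) q.2.1 q.2.2 else 0 := by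
  rw [constantCoeff_vectorField_X, coeff_evalOne, loopElt, loopSeries_single, coeff_single]
  split_ifs <;> simp

theorem cellRep_loopElt_natCast (x : 𝔤) (n : ℕ) :
    cellRep ρ (loopElt x n) (deltaOne κ) = 0 :=
  LinearMap.ext <| constantCoeff_derivation (vectorField _) fun q =>
    (constantCoeff_vectorField_loopElt_X ρ x n q).trans (if_neg (by omega))

/-- The map from the vacuum module to distributions that sends the vacuum to `deltaOne`. -/
def curToCell : Cur 𝔤 →ₗ[ℂ] Module.Dual ℂ (CellRing κ) :=
  ((annihIdeal 𝔤).restrictScalars ℂ).liftQ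
    (LinearMap.applyₗ (deltaOne κ) ∘ₗ
      (UniversalEnvelopingAlgebra.lift ℂ (cellRep ρ)).toLinearMap) (by
    intro u hu
    rw [LinearMap.mem_ker]
    change UniversalEnvelopingAlgebra.lift ℂ (cellRep ρ) u (deltaOne κ) = 0
    replace hu : u ∈ annihIdeal 𝔤 := hu
    induction hu using Submodule.span_induction with
    | mem u h =>
      obtain ⟨x, n, rfl⟩ := h
      rw [UniversalEnvelopingAlgebra.lift_ι_apply, cellRep_loopElt_natCast]
    | zero => simp
    | add u u' _ _ h h' => rw [map_add, LinearMap.add_apply, h, h', add_zero]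
    | smul r u _ h => rw [smul_eq_mul, map_mul, Module.End.mul_apply, h, map_zero]) ∘ₗ
    (Submodule.Quotient.restrictScalarsEquiv ℂ (annihIdeal 𝔤)).symm.toLinearMap

/-- The state `j_(-1)^x|0⟩` of the current algebra. -/
def currentState (x : 𝔤) : Cur 𝔤 :=
  (UniversalEnvelopingAlgebra.ι ℂ (loopElt x (-1)) : LoopU 𝔤) • curVac 𝔤

theorem curToCell_currentState (x : 𝔤) (i j : κ) :
    curToCell ρ (currentState x) (MvPolynomial.X (0, i, j)) = ρ (1 ⊗ₜ x) i j := by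
  change UniversalEnvelopingAlgebra.lift ℂ (cellRep ρ)
    (UniversalEnvelopingAlgebra.ι ℂ (loopElt x (-1)) * 1) (deltaOne κ) _ = _
  rw [mul_one, UniversalEnvelopingAlgebra.lift_ι_apply]
  exact constantCoeff_vectorField_loopElt_X ρ x (-1) (0, i, j)

theorem linearIndependent_currentState {ι : Type*} {x : ι → 𝔤}
    (h : LinearIndependent ℂ fun a => ρ (1 ⊗ₜ x a)) :
    LinearIndependent ℂ fun a => currentState (x a) := by
  let entries : Module.Dual ℂ (CellRing κ) →ₗ[ℂ] Matrix κ κ ℂ :=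
    { toFun φ := Matrix.of fun i j => φ (MvPolynomial.X (0, i, j))
      map_add' _ _ := rfl
      map_smul' _ _ := rfl }
  refine LinearIndependent.of_comp (entries ∘ₗ curToCell ρ) ?_
  convert h with a
  exact Matrix.ext fun i j => curToCell_currentState ρ (x a) i j

end LoopRepresentation

section StateSpace

attribute [local instance 100] LieRing.ofAssociativeRing

variable {𝔤 : Type*} [LieRing 𝔤] [LieAlgebra ℝ 𝔤] {d : ℕ}

theorem State.hom_ext {M : Type*} [AddCommGroup M] [Module ℂ M] {S T : State 𝔤 d →ₗ[ℂ] M}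
    (h : ∀ f p w u, S (f ⊗ₜ[ℂ] (p ⊗ₜ[ℂ] (w ⊗ₜ[ℂ] u))) = T (f ⊗ₜ[ℂ] (p ⊗ₜ[ℂ] (w ⊗ₜ[ℂ] u)))) :
    S = T := by
  refine TensorProduct.ext' fun f x => ?_
  induction x with
  | zero => simp only [TensorProduct.tmul_zero, map_zero]
  | add x y hx hy => simp only [TensorProduct.tmul_add, map_add, hx, hy]
  | tmul p y =>
    induction y with
    | zero => simp only [TensorProduct.tmul_zero, map_zero]
    | add x y hx hy => simp only [TensorProduct.tmul_add, map_add, hx, hy]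
    | tmul w u => exact h f p w u

section Apply

variable (f : SmoothFn d) (p : Bos d) (w : Fer d) (u : Cur 𝔤)

@[simp] theorem onFn_tmul (T : Module.End ℂ (SmoothFn d)) :
    onFn T (f ⊗ₜ[ℂ] (p ⊗ₜ[ℂ] (w ⊗ₜ[ℂ] u)) : State 𝔤 d) = T f ⊗ₜ[ℂ] (p ⊗ₜ[ℂ] (w ⊗ₜ[ℂ] u)) := by
  simp only [onFn, LinearMap.rTensor_tmul]

@[simp] theorem onBos_tmul (T : Module.End ℂ (Bos d)) :
    onBos T (f ⊗ₜ[ℂ] (p ⊗ₜ[ℂ] (w ⊗ₜ[ℂ] u)) : State 𝔤 d) = f ⊗ₜ[ℂ] (T p ⊗ₜ[ℂ] (w ⊗ₜ[ℂ] u)) := by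
  simp only [onBos, LinearMap.lTensor_tmul, LinearMap.rTensor_tmul]

@[simp] theorem onFer_tmul (T : Module.End ℂ (Fer d)) :
    onFer T (f ⊗ₜ[ℂ] (p ⊗ₜ[ℂ] (w ⊗ₜ[ℂ] u)) : State 𝔤 d) = f ⊗ₜ[ℂ] (p ⊗ₜ[ℂ] (T w ⊗ₜ[ℂ] u)) := by
  simp only [onFer, LinearMap.lTensor_tmul, LinearMap.rTensor_tmul]

@[simp] theorem onCur_tmul (T : Module.End ℂ (Cur 𝔤)) :
    onCur T (f ⊗ₜ[ℂ] (p ⊗ₜ[ℂ] (w ⊗ₜ[ℂ] u)) : State 𝔤 d) = f ⊗ₜ[ℂ] (p ⊗ₜ[ℂ] (w ⊗ₜ[ℂ] T u)) := by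
  simp only [onCur, LinearMap.lTensor_tmul]

end Apply

theorem onBos_mul (S T : Module.End ℂ (Bos d)) :
    (onBos (S * T) : Module.End ℂ (State 𝔤 d)) = onBos S * onBos T := by
  simp only [onBos, LinearMap.rTensor_mul, LinearMap.lTensor_mul]

theorem commute_onFn_onBos (S : Module.End ℂ (SmoothFn d)) (T : Module.End ℂ (Bos d)) :
    Commute (onFn S : Module.End ℂ (State 𝔤 d)) (onBos T) :=
  State.hom_ext fun _ _ _ _ => by simp only [Module.End.mul_apply, onFn_tmul, onBos_tmul]

theorem commute_onFn_onFer (S : Module.End ℂ (SmoothFn d)) (T : Module.End ℂ (Fer d)) :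
    Commute (onFn S : Module.End ℂ (State 𝔤 d)) (onFer T) :=
  State.hom_ext fun _ _ _ _ => by simp only [Module.End.mul_apply, onFn_tmul, onFer_tmul]

theorem commute_onFn_onCur (S : Module.End ℂ (SmoothFn d)) (T : Module.End ℂ (Cur 𝔤)) :
    Commute (onFn S : Module.End ℂ (State 𝔤 d)) (onCur T) :=
  State.hom_ext fun _ _ _ _ => by simp only [Module.End.mul_apply, onFn_tmul, onCur_tmul]

theorem commute_onBos_onFer (S : Module.End ℂ (Bos d)) (T : Module.End ℂ (Fer d)) :
    Commute (onBos S : Module.End ℂ (State 𝔤 d)) (onFer T) :=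
  State.hom_ext fun _ _ _ _ => by simp only [Module.End.mul_apply, onBos_tmul, onFer_tmul]

theorem commute_onBos_onCur (S : Module.End ℂ (Bos d)) (T : Module.End ℂ (Cur 𝔤)) :
    Commute (onBos S : Module.End ℂ (State 𝔤 d)) (onCur T) :=
  State.hom_ext fun _ _ _ _ => by simp only [Module.End.mul_apply, onBos_tmul, onCur_tmul]

theorem commute_onFer_onCur (S : Module.End ℂ (Fer d)) (T : Module.End ℂ (Cur 𝔤)) :
    Commute (onFer S : Module.End ℂ (State 𝔤 d)) (onCur T) :=
  State.hom_ext fun _ _ _ _ => by simp only [Module.End.mul_apply, onFer_tmul, onCur_tmul]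

variable (v : State 𝔤 d)

theorem bAnn_bCre_of_ne {i j : BMode d} (h : i ≠ j) : bAnn i (bCre j v) = bCre j (bAnn i v) :=
  LinearMap.congr_fun (f := bAnn i * bCre j) (g := bCre j * bAnn i)
    (State.hom_ext fun f p w u => by
      simp [bAnn, bCre, Derivation.leibniz, MvPolynomial.pderiv_X_of_ne h.symm]) v

theorem bAnn_bCre_self (i : BMode d) : bAnn i (bCre i v) = v + bCre i (bAnn i v) :=
  LinearMap.congr_fun (f := bAnn i * bCre i) (g := 1 + bCre i * bAnn i)
    (State.hom_ext fun f p w u => by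
      simp [bAnn, bCre, Derivation.leibniz, TensorProduct.tmul_add, TensorProduct.add_tmul,
        add_comm]) v

theorem commute_pderiv {σ R : Type*} [CommRing R] (i j : σ) :
    Commute (MvPolynomial.pderiv i).toLinearMap (MvPolynomial.pderiv (R := R) j).toLinearMap := by
  classical
  have lie_eq_zero : ⁅MvPolynomial.pderiv (R := R) i, MvPolynomial.pderiv j⁆ = 0 :=
    MvPolynomial.derivation_ext fun k => by
      rw [Derivation.commutator_apply]
      simp [MvPolynomial.pderiv_X, Pi.single_apply, apply_ite]
  refine LinearMap.ext fun p => sub_eq_zero.mp ?_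
  simpa only [Derivation.commutator_apply] using! DFunLike.congr_fun lie_eq_zero p

theorem bAnn_bAnn (i j : BMode d) : bAnn i (bAnn j v) = bAnn j (bAnn i v) :=
  LinearMap.congr_fun (f := bAnn i * bAnn j) (g := bAnn j * bAnn i) (by
    rw [bAnn, bAnn, ← onBos_mul, ← onBos_mul, commute_pderiv]) v

theorem fAnn_fCre (i j : FMode d) :
    fAnn i (fCre j v) = (Finsupp.single j 1 i : ℂ) • v - fCre j (fAnn i v) :=
  LinearMap.congr_fun (f := fAnn i * fCre j)
    (g := (Finsupp.single j 1 i : ℂ) • LinearMap.id - fCre j * fAnn i)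
    (State.hom_ext fun f p w u => by
      simp only [Module.End.mul_apply, fCre, fAnn, onFer_tmul, LinearMap.mulLeft_apply,
        ExteriorAlgebra.ι, CliffordAlgebra.contractLeft_ι_mul, Finsupp.lapply_apply,
        LinearMap.sub_apply, LinearMap.smul_apply, LinearMap.id_apply, TensorProduct.sub_tmul,
        TensorProduct.tmul_sub, ← TensorProduct.smul_tmul', TensorProduct.tmul_smul]) v

theorem fAnn_fCre_self (i : FMode d) : fAnn i (fCre i v) = v - fCre i (fAnn i v) := by
  rw [fAnn_fCre, Finsupp.single_eq_same, one_smul]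

theorem fAnn_fCre_of_ne {i j : FMode d} (h : i ≠ j) : fAnn i (fCre j v) = -fCre j (fAnn i v) := by
  rw [fAnn_fCre, Finsupp.single_eq_of_ne h, zero_smul, zero_sub]

theorem fAnn_fAnn (i j : FMode d) : fAnn i (fAnn j v) = -fAnn j (fAnn i v) :=
  LinearMap.congr_fun (f := fAnn i * fAnn j) (g := -(fAnn j * fAnn i))
    (State.hom_ext fun f p w u => by
      simp only [Module.End.mul_apply, fAnn, onFer_tmul, LinearMap.neg_apply,
        CliffordAlgebra.contractLeft_comm (d := Finsupp.lapply i) (d' := Finsupp.lapply j) w,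
        TensorProduct.neg_tmul, TensorProduct.tmul_neg]) v

theorem fCre_fCre (i j : FMode d) : fCre i (fCre j v) = -fCre j (fCre i v) := by
  have anticomm (w : Fer d) :
      ExteriorAlgebra.ι ℂ (Finsupp.single i 1) * (ExteriorAlgebra.ι ℂ (Finsupp.single j 1) * w) =
        -(ExteriorAlgebra.ι ℂ (Finsupp.single j 1) *
          (ExteriorAlgebra.ι ℂ (Finsupp.single i 1) * w)) := by
    rw [← mul_assoc, ← mul_assoc, ← neg_mul,
      eq_neg_of_add_eq_zero_left (ExteriorAlgebra.ι_add_mul_swap _ _)]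
  exact LinearMap.congr_fun (f := fCre i * fCre j) (g := -(fCre j * fCre i))
    (State.hom_ext fun f p w u => by
      simp only [Module.End.mul_apply, fCre, onFer_tmul, LinearMap.neg_apply,
        LinearMap.mulLeft_apply, anticomm w, TensorProduct.neg_tmul, TensorProduct.tmul_neg]) v

theorem fCre_self (i : FMode d) : fCre i (fCre i v) = 0 :=
  have := IsAddTorsionFree.of_module_rat (State 𝔤 d)
  self_eq_neg.mp (fCre_fCre v i i)

/-- The mode `j(x)_(n)` of the current as a linear operator on states. -/
def opJ (x : 𝔤) (n : ℤ) : Module.End ℂ (State 𝔤 d) :=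
  onCur (Algebra.lsmul ℂ ℂ (Cur 𝔤) (UniversalEnvelopingAlgebra.ι ℂ (loopElt x n)))

theorem lie_loopElt (x y : 𝔤) (m n : ℤ) :
    ⁅loopElt x m, loopElt y n⁆ = loopElt ⁅x, y⁆ (m + n) := by
  rw [loopElt, loopElt, LieAlgebra.ExtendScalars.bracket_tmul,
    LieAlgebra.ExtendScalars.bracket_tmul, AddMonoidAlgebra.single_mul_single, one_mul, loopElt]

theorem opJ_opJ (x y : 𝔤) (m n : ℤ) :
    opJ x m (opJ y n v) = opJ y n (opJ x m v) + opJ ⁅x, y⁆ (m + n) v := by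
  have comm : UniversalEnvelopingAlgebra.ι ℂ (loopElt x m) *
        UniversalEnvelopingAlgebra.ι ℂ (loopElt y n) =
      UniversalEnvelopingAlgebra.ι ℂ (loopElt y n) * UniversalEnvelopingAlgebra.ι ℂ (loopElt x m) +
      UniversalEnvelopingAlgebra.ι ℂ (loopElt ⁅x, y⁆ (m + n)) := by
    rw [← lie_loopElt, LieHom.map_lie, LieRing.of_associative_ring_bracket, add_sub_cancel]
  exact LinearMap.congr_fun (f := opJ x m * opJ y n)
    (g := opJ y n * opJ x m + opJ ⁅x, y⁆ (m + n)) (State.hom_ext fun f p w u => by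
      simp only [Module.End.mul_apply, opJ, onCur_tmul, LinearMap.add_apply, Algebra.lsmul_coe,
        ← mul_smul, comm, add_smul, TensorProduct.tmul_add]) v

theorem loopElt_smul (r : ℝ) (x : 𝔤) (n : ℤ) : loopElt (r • x) n = (r : ℂ) • loopElt x n := by
  rw [loopElt, TensorProduct.tmul_smul, loopElt, ← TensorProduct.tmul_smul (r : ℂ),
    Complex.coe_smul]
  rfl

theorem opJ_sum {κ : Type*} (s : Finset κ) (r : κ → ℝ) (x : κ → 𝔤) (n : ℤ) :
    opJ (∑ k ∈ s, r k • x k) n v = ∑ k ∈ s, (r k : ℂ) • opJ (x k) n v := by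
  have loopElt_sum : loopElt (∑ k ∈ s, r k • x k) n = ∑ k ∈ s, (r k : ℂ) • loopElt (x k) n := by
    simp only [← loopElt_smul]
    simp only [loopElt, TensorProduct.tmul_sum]
  have lsmul_sum : Algebra.lsmul ℂ ℂ (Cur 𝔤) (UniversalEnvelopingAlgebra.ι ℂ
      (loopElt (∑ k ∈ s, r k • x k) n)) = ∑ k ∈ s, (r k : ℂ) •
        Algebra.lsmul ℂ ℂ (Cur 𝔤) (UniversalEnvelopingAlgebra.ι ℂ (loopElt (x k) n)) := by
    simp only [loopElt_sum, map_sum, map_smul]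
  simp only [opJ, onCur, lsmul_sum, ← LinearMap.coe_lTensorHom, map_sum, map_smul,
    LinearMap.sum_apply, LinearMap.smul_apply]

theorem opJ_natCast_fnState (x : 𝔤) (n : ℕ) (f : SmoothFn d) : opJ x n (fnState 𝔤 f) = 0 := by
  have h : (UniversalEnvelopingAlgebra.ι ℂ (loopElt x n) : LoopU 𝔤) • curVac 𝔤 = 0 := by
    refine (Submodule.Quotient.mk_eq_zero (annihIdeal 𝔤)).mpr ?_
    change _ * (1 : LoopU 𝔤) ∈ _
    rw [mul_one]
    exact Submodule.subset_span ⟨x, n, rfl⟩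
  simp only [opJ, fnState, onCur_tmul, Algebra.lsmul_coe, h, TensorProduct.tmul_zero]

end StateSpace

section Stability

variable {𝔤 : Type*} [LieRing 𝔤] [LieAlgebra ℝ 𝔤] {d : ℕ}

/-- Every mode of the field `Φ` maps the subspace `S` to itself.  For `S = ⊥` this says that all
modes of `Φ` send `0` to `0`, which is part of the linearity that `WField` does not bundle. -/
def Stable (S : Submodule ℂ (State 𝔤 d)) (Φ : WField 𝔤 d) : Prop := ∀ n, ∀ v ∈ S, Φ n v ∈ S

variable {S : Submodule ℂ (State 𝔤 d)} {Φ Ψ : WField 𝔤 d}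

namespace Stable

theorem map_zero (h : Stable ⊥ Φ) (n : ℤ) : Φ n 0 = 0 := (Submodule.mem_bot ℂ).mp (h n 0 rfl)

theorem nopSign (s : ℂ) (hΦ : Stable S Φ) (hΨ : Stable S Ψ) : Stable S (nopSign s Φ Ψ) := by
  refine fun n v hv => finsum_induction (· ∈ S) S.zero_mem (fun _ _ => S.add_mem) fun m => ?_
  split_ifs
  · exact hΦ _ _ (hΨ _ _ hv)
  · exact S.smul_mem _ (hΨ _ _ (hΦ _ _ hv))

theorem nop (hΦ : Stable S Φ) (hΨ : Stable S Ψ) : Stable S (nop Φ Ψ) := nopSign 1 hΦ hΨ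

theorem nopF (hΦ : Stable S Φ) (hΨ : Stable S Ψ) : Stable S (nopF Φ Ψ) := nopSign (-1) hΦ hΨ

theorem add (hΦ : Stable S Φ) (hΨ : Stable S Ψ) : Stable S (Φ + Ψ) :=
  fun n v hv => S.add_mem (hΦ n v hv) (hΨ n v hv)

theorem sub (hΦ : Stable S Φ) (hΨ : Stable S Ψ) : Stable S (Φ - Ψ) :=
  fun n v hv => S.sub_mem (hΦ n v hv) (hΨ n v hv)

theorem neg (hΦ : Stable S Φ) : Stable S (-Φ) := fun n v hv => S.neg_mem (hΦ n v hv)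

theorem smul (s : ℂ) (hΦ : Stable S Φ) : Stable S (s • Φ) :=
  fun n v hv => S.smul_mem s (hΦ n v hv)

theorem del (hΦ : Stable S Φ) : Stable S (del Φ) := fun n v hv => S.smul_mem _ (hΦ (n - 1) v hv)

theorem sum {κ : Type*} [Fintype κ] {Φ : κ → WField 𝔤 d} (h : ∀ k, Stable S (Φ k)) :
    Stable S (∑ k, Φ k) := fun n v hv => by
  simpa only [Finset.sum_apply] using S.sum_mem fun k _ => h k n v hv

theorem foldr_fX (hX : ∀ μ, Stable S (fX μ)) {v : State 𝔤 d} (hv : v ∈ S)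
    (l : List (Fin d × ℤ)) : l.foldr (fun q w => fX q.1 q.2 w) v ∈ S := by
  induction l with
  | nil => exact hv
  | cons q l ih => exact hX _ _ _ ih

end Stable

/-- The subspace `S` is stable under all the operators the elementary fields are made of, except
possibly the bosonic creation operators in `B` and the fermionic annihilation operators in `F`.
These are the operators that fail to commute with an annihilation operator `bAnn i`, respectively a
creation operator `fCre i`, so that the notion covers kernels of such operators. -/
structure ModeStable (S : Submodule ℂ (State 𝔤 d)) (B : Set (BMode d)) (F : Set (FMode d)) :
    Prop where
  onFn : ∀ T, ∀ v ∈ S, onFn T v ∈ S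
  onCur : ∀ T, ∀ v ∈ S, onCur T v ∈ S
  bAnn : ∀ i, ∀ v ∈ S, bAnn i v ∈ S
  bCre : ∀ i ∉ B, ∀ v ∈ S, bCre i v ∈ S
  fCre : ∀ i, ∀ v ∈ S, fCre i v ∈ S
  fAnn : ∀ i ∉ F, ∀ v ∈ S, fAnn i v ∈ S

theorem map_mem_ker_of_commute {M : Type*} [AddCommGroup M] [Module ℂ M] {S T : Module.End ℂ M}
    (h : Commute S T) {v : M} (hv : v ∈ LinearMap.ker S) : T v ∈ LinearMap.ker S := by
  rw [LinearMap.mem_ker] at hv ⊢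
  rw [← Module.End.mul_apply, h.eq, Module.End.mul_apply, hv, map_zero]

theorem modeStable_bot : ModeStable (⊥ : Submodule ℂ (State 𝔤 d)) ∅ ∅ := by
  constructor <;> simp

theorem modeStable_ker_bAnn (i : BMode d) :
    ModeStable (LinearMap.ker (bAnn (𝔤 := 𝔤) i)) {i} ∅ where
  onFn _ _ := map_mem_ker_of_commute (commute_onFn_onBos _ _).symm
  onCur _ _ := map_mem_ker_of_commute (commute_onBos_onCur _ _)
  bAnn j _ := map_mem_ker_of_commute (LinearMap.ext fun v => bAnn_bAnn v i j)
  bCre _ hj _ := map_mem_ker_of_commute (LinearMap.ext fun v => bAnn_bCre_of_ne v (Ne.symm hj))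
  fCre _ _ := map_mem_ker_of_commute (commute_onBos_onFer _ _)
  fAnn _ _ _ := map_mem_ker_of_commute (commute_onBos_onFer _ _)

theorem modeStable_ker_fCre (i : FMode d) :
    ModeStable (LinearMap.ker (fCre (𝔤 := 𝔤) i)) ∅ {i} where
  onFn _ _ := map_mem_ker_of_commute (commute_onFn_onFer _ _).symm
  onCur _ _ := map_mem_ker_of_commute (commute_onFer_onCur _ _)
  bAnn _ _ := map_mem_ker_of_commute (commute_onBos_onFer _ _).symm
  bCre _ _ _ := map_mem_ker_of_commute (commute_onBos_onFer _ _).symm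
  fCre j v hv := by
    rw [LinearMap.mem_ker] at hv ⊢
    rw [fCre_fCre, hv, map_zero, neg_zero]
  fAnn j hj v hv := by
    rw [LinearMap.mem_ker] at hv ⊢
    rw [← neg_eq_zero, ← fAnn_fCre_of_ne v hj, hv, map_zero]

namespace ModeStable

variable {B : Set (BMode d)} {F : Set (FMode d)} (h : ModeStable S B F)
include h

theorem fX {μ : Fin d} (hB : ∀ k, .x μ k ∉ B) : Stable S (fX μ)
  | Int.negSucc 0, v, hv => h.onFn _ v hv
  | Int.negSucc (k + 1), v, hv => h.bCre _ (hB k) v hv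
  | Int.ofNat _, v, hv => h.bAnn _ v hv

theorem fPi {μ : Fin d} (hB : ∀ k, .p μ k ∉ B) : Stable S (fPi μ)
  | Int.negSucc k, v, hv => h.bCre _ (hB k) v hv
  | Int.ofNat 0, v, hv => S.neg_mem (h.onFn _ v hv)
  | Int.ofNat (_ + 1), v, hv => S.neg_mem (h.bAnn _ v hv)

theorem fPsi {μ : Fin d} (hF : ∀ k, .ψ μ k ∉ F) : Stable S (fPsi μ)
  | Int.negSucc _, v, hv => h.fCre _ v hv
  | Int.ofNat n, v, hv => S.smul_mem _ (h.fAnn _ (hF n) v hv)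

theorem fC (hF : ∀ k, .b k ∉ F) : Stable S fC
  | Int.negSucc _, v, hv => h.fCre _ v hv
  | Int.ofNat n, v, hv => h.fAnn _ (hF n) v hv

theorem fB (hF : ∀ k, .c k ∉ F) : Stable S fB
  | Int.negSucc _, v, hv => h.fCre _ v hv
  | Int.ofNat n, v, hv => h.fAnn _ (hF n) v hv

theorem fCbar (hF : ∀ k, .bbar k ∉ F) : Stable S fCbar
  | Int.negSucc _, v, hv => h.fCre _ v hv
  | Int.ofNat n, v, hv => h.fAnn _ (hF n) v hv

theorem fBbar (hF : ∀ k, .cbar k ∉ F) : Stable S fBbar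
  | Int.negSucc _, v, hv => h.fCre _ v hv
  | Int.ofNat n, v, hv => h.fAnn _ (hF n) v hv

theorem fGamma (hB : ∀ k, .γ k ∉ B) : Stable S fGamma
  | Int.negSucc 0, v, hv => h.bAnn _ v hv
  | Int.negSucc (k + 1), v, hv => h.bCre _ (hB k) v hv
  | Int.ofNat _, v, hv => h.bAnn _ v hv

theorem fBeta (hB : ∀ k, .β k ∉ B) : Stable S fBeta
  | Int.negSucc k, v, hv => h.bCre _ (hB (k + 1)) v hv
  | Int.ofNat 0, v, hv => h.bCre _ (hB 0) v hv
  | Int.ofNat (_ + 1), v, hv => S.neg_mem (h.bAnn _ v hv)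

theorem fJ (x : 𝔤) : Stable S (fJ x) := fun _ v hv => h.onCur _ v hv

theorem fFn (hB : ∀ μ k, .x μ k ∉ B) (f : SmoothFn d) : Stable S (fFn f) := by
  refine fun n v hv => finsum_induction (· ∈ S) S.zero_mem (fun _ _ => S.add_mem) fun l => ?_
  split_ifs
  · exact S.smul_mem _ (h.onFn _ _ (Stable.foldr_fX (fun μ => h.fX (hB μ)) hv l))
  · exact S.zero_mem

variable {ι : Type*} [Fintype ι] (e : Module.Basis ι ℝ 𝔤)

theorem curG (hx : ∀ μ k, .x μ k ∉ B) (hp : ∀ μ k, .p μ k ∉ B) (hψ : ∀ μ k, .ψ μ k ∉ F)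
    (A : Fin d → ι → SmoothFn d) : Stable S (curG e A) :=
  .sum fun μ => (h.fPsi (hψ μ)).nop <|
    (h.fPi (hp μ)).sub <| .sum fun _ => (h.fFn hx _).nop (h.fJ _)

theorem curH (hx : ∀ μ k, .x μ k ∉ B) (hp : ∀ μ k, .p μ k ∉ B) (hψ : ∀ μ k, .ψ μ k ∉ F)
    (A : Fin d → ι → SmoothFn d) : Stable S (curH e A) := by
  have hPi (μ : Fin d) := h.fPi (hp μ)
  have hψ (μ : Fin d) := h.fPsi (hψ μ)
  have hfj (f : SmoothFn d) (x : 𝔤) := (h.fFn hx f).nop (h.fJ x)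
  exact (((((Stable.sum fun μ => ((hPi μ).nop (hPi μ)).smul _).sub
    ((Stable.sum fun μ => (Stable.sum fun _ => (hPi μ).nop (hfj _ _)).smul _).smul _)).add
    (.sum fun _ => (Stable.sum fun _ => Stable.sum fun _ =>
      (h.fFn hx _).nop ((h.fJ _).nop (h.fJ _))).smul _)).add
    (.sum fun μ => .sum fun ν => .sum fun _ => ((hψ μ).nopF (hψ ν)).nop (hfj _ _))).sub
    (Stable.sum fun _ => (Stable.sum fun _ => hfj _ _).smul _).del).add
    (.sum fun _ => .sum fun _ => .sum fun _ => (Stable.sum fun _ =>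
      ((h.fJ _).nop ((h.fFn hx _).nop (h.fFn hx _).del)).smul _).smul _)

omit h in
theorem stressT (h : ModeStable S ∅ F) (hψ : ∀ μ k, .ψ μ k ∉ F) (hc : ∀ k, .cbar k ∉ F)
    (hb : ∀ k, .bbar k ∉ F) (C : ℝ) : Stable S (stressT e C) := by
  have hPi (μ : Fin d) := h.fPi (μ := μ) (by simp)
  have hX (μ : Fin d) := h.fX (μ := μ) (by simp)
  have hγ := h.fGamma (by simp)
  have hβ := h.fBeta (by simp)
  exact ((((Stable.sum fun μ => (hPi μ).nop (hX μ).del).neg.sub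
    ((Stable.sum fun μ => ((h.fPsi (hψ μ)).nopF (h.fPsi (hψ μ)).del).smul _).smul _)).sub
    ((Stable.sum fun _ => (h.fJ _).nop (h.fJ _)).smul _)).add
    (((h.fCbar hb).nopF (h.fBbar hc).del).sub (((h.fBbar hc).nopF (h.fCbar hb).del).smul _))).add
    (((hβ.nop hγ.del).smul _).neg.sub ((hγ.nop hβ.del).smul _))

end ModeStable

end Stability

section TopModes

variable {𝔤 : Type*} [LieRing 𝔤] [LieAlgebra ℝ 𝔤] {d : ℕ} {Φ Ψ : WField 𝔤 d}

theorem nopSign_eq_add_add (s : ℂ) (n : ℤ) (v : State 𝔤 d)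
    (hneg : ∀ m < -2, Φ m (Ψ (n - m - 1) v) = 0) (hpos : ∀ m > 0, Ψ (n - m - 1) (Φ m v) = 0) :
    nopSign s Φ Ψ n v =
      Φ (-2) (Ψ (n + 1) v) + Φ (-1) (Ψ n v) + s • Ψ (n - 1) (Φ 0 v) := by
  rw [nopSign, finsum_eq_sum_of_support_subset (s := {-2, -1, 0})]
  · rw [Finset.sum_insert (by decide), Finset.sum_insert (by decide), Finset.sum_singleton,
      if_pos (by decide), if_pos (by decide), if_neg (by decide),
      show n - -2 - 1 = n + 1 by ring, show n - -1 - 1 = n by ring, sub_zero, add_assoc]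
  · intro m hm
    contrapose! hm
    simp only [Finset.coe_insert, Finset.coe_singleton, Set.mem_insert_iff,
      Set.mem_singleton_iff, not_or] at hm
    rw [Function.notMem_support]
    split_ifs with h
    · exact hneg m (by omega)
    · rw [hpos m (by omega), smul_zero]

theorem nopSign_eq_add (s : ℂ) {n : ℤ} {v : State 𝔤 d} (hΦ₀ : Stable ⊥ Φ) (hΨ₀ : Stable ⊥ Ψ)
    (hΨ : ∀ k > n, Ψ k v = 0) (hΦ : ∀ m > 0, Φ m v = 0) :
    nopSign s Φ Ψ n v = Φ (-1) (Ψ n v) + s • Ψ (n - 1) (Φ 0 v) := by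
  rw [nopSign_eq_add_add, hΨ (n + 1) (by omega), hΦ₀.map_zero, zero_add]
  · intro m hm
    rw [hΨ _ (by omega), hΦ₀.map_zero]
  · intro m hm
    rw [hΦ m hm, hΨ₀.map_zero]

/-- On the subspace `S` the modes of `Φ` above the mode `p` vanish, and the mode `p` acts as the
operator `T`, which preserves `S`.  For a field of conformal weight `h` and the states of lowest
weight, `p = h - 1` and `T` is the zero mode in the usual numbering: the rules below are those of
the Zhu algebra. -/
structure HasTopMode (S : Submodule ℂ (State 𝔤 d)) (Φ : WField 𝔤 d) (p : ℤ)
    (T : Module.End ℂ (State 𝔤 d)) : Prop where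
  stable_bot : Stable ⊥ Φ
  map_mem : ∀ v ∈ S, T v ∈ S
  eq_top : ∀ v ∈ S, Φ p v = T v
  eq_zero : ∀ n > p, ∀ v ∈ S, Φ n v = 0

namespace HasTopMode

variable {S : Submodule ℂ (State 𝔤 d)} {p q : ℤ} {T U : Module.End ℂ (State 𝔤 d)}

theorem congr (hΦ : HasTopMode S Φ p T) (hTU : T = U) : HasTopMode S Φ p U := hTU ▸ hΦ

theorem add (hΦ : HasTopMode S Φ p T) (hΨ : HasTopMode S Ψ p U) :
    HasTopMode S (Φ + Ψ) p (T + U) where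
  stable_bot := hΦ.stable_bot.add hΨ.stable_bot
  map_mem v hv := S.add_mem (hΦ.map_mem v hv) (hΨ.map_mem v hv)
  eq_top v hv := congrArg₂ (· + ·) (hΦ.eq_top v hv) (hΨ.eq_top v hv)
  eq_zero n hn v hv := (congrArg₂ (· + ·) (hΦ.eq_zero n hn v hv) (hΨ.eq_zero n hn v hv)).trans
    (add_zero 0)

theorem smul (s : ℂ) (hΦ : HasTopMode S Φ p T) : HasTopMode S (s • Φ) p (s • T) where
  stable_bot := hΦ.stable_bot.smul s
  map_mem v hv := S.smul_mem s (hΦ.map_mem v hv)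
  eq_top v hv := congrArg (s • ·) (hΦ.eq_top v hv)
  eq_zero n hn v hv := (congrArg (s • ·) (hΦ.eq_zero n hn v hv)).trans (smul_zero s)

theorem neg (hΦ : HasTopMode S Φ p T) : HasTopMode S (-Φ) p (-T) := by
  have neg_eq {M : Type _} [AddCommGroup M] [Module ℂ M] (x : M) : -x = (-1 : ℂ) • x := by simp
  rw [neg_eq Φ, neg_eq T]
  exact hΦ.smul (-1)

theorem sub (hΦ : HasTopMode S Φ p T) (hΨ : HasTopMode S Ψ p U) :
    HasTopMode S (Φ - Ψ) p (T - U) := by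
  simpa only [sub_eq_add_neg] using hΦ.add hΨ.neg

theorem sum {κ : Type*} [Fintype κ] {Φ : κ → WField 𝔤 d} {T : κ → Module.End ℂ (State 𝔤 d)}
    (h : ∀ k, HasTopMode S (Φ k) p (T k)) : HasTopMode S (∑ k, Φ k) p (∑ k, T k) where
  stable_bot := .sum fun k => (h k).stable_bot
  map_mem v hv := by
    simpa only [LinearMap.sum_apply] using S.sum_mem fun k _ => (h k).map_mem v hv
  eq_top v hv := by
    simp only [Finset.sum_apply, LinearMap.sum_apply, (h _).eq_top v hv]
  eq_zero n hn v hv := by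
    simp only [Finset.sum_apply, (h _).eq_zero n hn v hv, Finset.sum_const_zero]

theorem del (hΦ : HasTopMode S Φ p T) : HasTopMode S (del Φ) (p + 1) (-((p : ℂ) + 1) • T) where
  stable_bot := hΦ.stable_bot.del
  map_mem v hv := S.smul_mem _ (hΦ.map_mem v hv)
  eq_top v hv := by
    rw [Ambitwistor.del, add_sub_cancel_right, hΦ.eq_top v hv, LinearMap.smul_apply,
      Int.cast_add, Int.cast_one]
  eq_zero n hn v hv := by
    rw [Ambitwistor.del, hΦ.eq_zero (n - 1) (by omega) v hv, smul_zero]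

theorem nopSign_of_top_neg_one (s : ℂ) (hΦ : HasTopMode S Φ (-1) T) (hΨ : HasTopMode S Ψ q U) :
    HasTopMode S (nopSign s Φ Ψ) q (T * U) := by
  have two_terms {n : ℤ} (hn : q ≤ n) {v : State 𝔤 d} (hv : v ∈ S) :
      Ambitwistor.nopSign s Φ Ψ n v = Φ (-1) (Ψ n v) := by
    rw [nopSign_eq_add _ hΦ.stable_bot hΨ.stable_bot
      (fun k hk => hΨ.eq_zero k (by omega) v hv) (fun m hm => hΦ.eq_zero m (by omega) v hv),
      hΦ.eq_zero 0 (by omega) v hv, hΨ.stable_bot.map_zero, smul_zero, add_zero]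
  refine ⟨hΦ.stable_bot.nopSign s hΨ.stable_bot, fun v hv => hΦ.map_mem _ (hΨ.map_mem v hv),
    fun v hv => ?_, fun n hn v hv => ?_⟩
  · rw [two_terms le_rfl hv, hΨ.eq_top v hv, hΦ.eq_top _ (hΨ.map_mem v hv), Module.End.mul_apply]
  · rw [two_terms hn.le hv, hΨ.eq_zero n hn v hv, hΦ.stable_bot.map_zero]

theorem nop_of_top_neg_one (hΦ : HasTopMode S Φ (-1) T) (hΨ : HasTopMode S Ψ q U) :
    HasTopMode S (nop Φ Ψ) q (T * U) := hΦ.nopSign_of_top_neg_one 1 hΨ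

theorem nopSign_of_top_zero (s : ℂ) (hΦ : HasTopMode S Φ 0 T) (hΨ : HasTopMode S Ψ q U)
    {n : ℤ} (hn : q ≤ n) {v : State 𝔤 d} (hv : v ∈ S) :
    nopSign s Φ Ψ n v = Φ (-1) (Ψ n v) + s • Ψ (n - 1) (T v) := by
  rw [nopSign_eq_add _ hΦ.stable_bot hΨ.stable_bot (fun k hk => hΨ.eq_zero k (by omega) v hv)
    (fun m hm => hΦ.eq_zero m hm v hv), hΦ.eq_top v hv]

theorem nop_of_top_zero (hΦ : HasTopMode S Φ 0 T) (hΨ : HasTopMode S Ψ q U) :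
    HasTopMode S (nop Φ Ψ) (q + 1) (U * T) := by
  have one_term {n : ℤ} (hn : q < n) {v : State 𝔤 d} (hv : v ∈ S) :
      Ambitwistor.nop Φ Ψ n v = Ψ (n - 1) (T v) := by
    rw [nop, nopSign_of_top_zero _ hΦ hΨ hn.le hv, hΨ.eq_zero n hn v hv,
      hΦ.stable_bot.map_zero, zero_add, one_smul]
  refine ⟨hΦ.stable_bot.nop hΨ.stable_bot, fun v hv => hΨ.map_mem _ (hΦ.map_mem v hv),
    fun v hv => ?_, fun n hn v hv => ?_⟩
  · rw [one_term (by omega) hv, add_sub_cancel_right, hΨ.eq_top _ (hΦ.map_mem v hv),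
      Module.End.mul_apply]
  · rw [one_term (by omega) hv, hΨ.eq_zero _ (by omega) _ (hΦ.map_mem v hv)]

end HasTopMode

end TopModes

section SmoothFunctions

variable {𝔤 : Type*} [LieRing 𝔤] [LieAlgebra ℝ 𝔤] {d : ℕ}

theorem bAnn_p_foldr_fX {v : State 𝔤 d} (hv : ∀ μ k, bAnn (.p μ k) v = 0) (μ : Fin d) (k : ℕ)
    (l : List (Fin d × ℤ)) : bAnn (.p μ k) (l.foldr (fun q w => fX q.1 q.2 w) v) = 0 :=
  Stable.foldr_fX (fun _ => (modeStable_ker_bAnn (.p μ k)).fX (by simp)) (hv μ k) l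

theorem foldr_fX_eq_zero {v : State 𝔤 d} (hv : ∀ μ k, bAnn (.p μ k) v = 0)
    {l : List (Fin d × ℤ)} (hl : ∃ q ∈ l, 0 ≤ q.2) :
    l.foldr (fun q w => fX q.1 q.2 w) v = 0 := by
  induction l with
  | nil => simp at hl
  | cons q l ih =>
    rw [List.foldr_cons]
    rcases le_or_gt 0 q.2 with hq | hq
    · obtain ⟨n, hn⟩ := Int.eq_ofNat_of_zero_le hq
      rw [hn]
      exact bAnn_p_foldr_fX hv q.1 n l
    · obtain ⟨r, hr, hr₀⟩ := hl
      rcases List.mem_cons.mp hr with rfl | hr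
      · exact absurd hr₀ hq.not_ge
      · rw [ih ⟨r, hr, hr₀⟩, (modeStable_bot.fX (by simp)).map_zero]

theorem length_le_sum_neg_sub_one {α : Type*} {l : List (α × ℤ)} (h : ∀ q ∈ l, q.2 ≤ -2) :
    (l.length : ℤ) ≤ (l.map fun q => -q.2 - 1).sum := by
  induction l with
  | nil => simp
  | cons q l ih =>
    have head := h q (by simp)
    have tail := ih fun r hr => h r (by simp [hr])
    simp only [List.length_cons, List.map_cons, List.sum_cons]
    omega

theorem exists_nonneg_of_sum_lt_length {α : Type*} {l : List (α × ℤ)} (hne : ∀ q ∈ l, q.2 ≠ -1)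
    (hl : (l.map fun q => -q.2 - 1).sum < (l.length : ℤ)) : ∃ q ∈ l, 0 ≤ q.2 := by
  by_contra! h
  have := length_le_sum_neg_sub_one (l := l) fun q hq => by
    have := h q hq
    have := hne q hq
    omega
  omega

theorem hasTopMode_fFn {S : Submodule ℂ (State 𝔤 d)} {f : SmoothFn d}
    (hp : ∀ v ∈ S, ∀ μ k, bAnn (.p μ k) v = 0) (hf : ∀ v ∈ S, mulFn f v ∈ S) :
    HasTopMode S (fFn f) (-1) (mulFn f) where
  stable_bot := modeStable_bot.fFn (by simp) f
  map_mem := hf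
  eq_top v hv := by
    rw [fFn, finsum_eq_single _ []]
    · simp
    · intro l hl
      have := List.length_pos_iff.mpr hl
      split_ifs with h
      · rw [foldr_fX_eq_zero (hp v hv) (exists_nonneg_of_sum_lt_length h.1 (by omega)), map_zero,
          smul_zero]
      · rfl
  eq_zero n hn v hv := by
    refine finsum_eq_zero_of_forall_eq_zero fun l => ?_
    split_ifs with h
    · rw [foldr_fX_eq_zero (hp v hv) (exists_nonneg_of_sum_lt_length h.1 (by omega)), map_zero,
        smul_zero]
    · rfl

end SmoothFunctions

section VertexSpace

variable {𝔤 : Type*} [LieRing 𝔤] [LieAlgebra ℝ 𝔤] {d : ℕ} {v : State 𝔤 d}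

/-- The conditions satisfied by the states of the fixed vertex operators `c c̄ δ(γ) ψ^μ f j^a`: the
lowest modes of `c` and `c̄` are filled, at most one lowest mode of `ψ` is, and apart from these
and from a single `j_(-1)` there are no excitations. -/
structure IsVertexState (v : State 𝔤 d) : Prop where
  bAnn i : bAnn i v = 0
  opJ (x : 𝔤) (n : ℕ) : opJ x (n + 1) v = 0
  fAnn i : (∀ μ, i ≠ .ψ μ 0) → i ≠ .c 0 → i ≠ .cbar 0 → fAnn i v = 0
  fAnn_fAnn μ ν : Ambitwistor.fAnn (.ψ μ 0) (Ambitwistor.fAnn (.ψ ν 0) v) = 0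
  fCre_c : fCre (.c 0) v = 0
  fCre_cbar : fCre (.cbar 0) v = 0

variable (𝔤 d) in
/-- The space of states satisfying `IsVertexState`, on which the currents `G`, `H` and `T` are
evaluated. -/
def vertexSpace : Submodule ℂ (State 𝔤 d) where
  carrier := {v | IsVertexState v}
  add_mem' hv hw :=
    ⟨fun i => by rw [map_add, hv.bAnn, hw.bAnn, add_zero],
      fun x n => by rw [map_add, hv.opJ, hw.opJ, add_zero],
      fun i h₁ h₂ h₃ => by rw [map_add, hv.fAnn i h₁ h₂ h₃, hw.fAnn i h₁ h₂ h₃, add_zero],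
      fun μ ν => by rw [map_add, map_add, hv.fAnn_fAnn, hw.fAnn_fAnn, add_zero],
      by rw [map_add, hv.fCre_c, hw.fCre_c, add_zero],
      by rw [map_add, hv.fCre_cbar, hw.fCre_cbar, add_zero]⟩
  zero_mem' := ⟨fun _ => map_zero _, fun _ _ => map_zero _, fun _ _ _ _ => map_zero _,
    fun _ _ => by rw [map_zero, map_zero], map_zero _, map_zero _⟩
  smul_mem' s v hv :=
    ⟨fun i => by rw [map_smul, hv.bAnn, smul_zero],
      fun x n => by rw [map_smul, hv.opJ, smul_zero],
      fun i h₁ h₂ h₃ => by rw [map_smul, hv.fAnn i h₁ h₂ h₃, smul_zero],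
      fun μ ν => by rw [map_smul, map_smul, hv.fAnn_fAnn, smul_zero],
      by rw [map_smul, hv.fCre_c, smul_zero],
      by rw [map_smul, hv.fCre_cbar, smul_zero]⟩

namespace IsVertexState

theorem map_of_commute (hv : IsVertexState v) {T : Module.End ℂ (State 𝔤 d)}
    (bos : ∀ U, Commute (onBos U) T) (fer : ∀ U, Commute (onFer U) T)
    (cur : ∀ x n, Ambitwistor.opJ x (n + 1 : ℕ) (T v) = 0) : IsVertexState (T v) where
  bAnn i := map_mem_ker_of_commute (bos _) (hv.bAnn i)
  opJ := cur
  fAnn i h₁ h₂ h₃ := map_mem_ker_of_commute (fer _) (hv.fAnn i h₁ h₂ h₃)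
  fAnn_fAnn μ ν := map_mem_ker_of_commute (S := Ambitwistor.fAnn _ * Ambitwistor.fAnn _)
    ((fer _).mul_left (fer _)) (hv.fAnn_fAnn μ ν)
  fCre_c := map_mem_ker_of_commute (fer _) hv.fCre_c
  fCre_cbar := map_mem_ker_of_commute (fer _) hv.fCre_cbar

theorem map_onFn (hv : IsVertexState v) (T : Module.End ℂ (SmoothFn d)) :
    IsVertexState (onFn T v) :=
  hv.map_of_commute (fun _ => (commute_onFn_onBos _ _).symm)
    (fun _ => (commute_onFn_onFer _ _).symm)
    fun x n => map_mem_ker_of_commute (commute_onFn_onCur _ _).symm (hv.opJ x n)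

theorem map_opJ (hv : IsVertexState v) (x : 𝔤) : IsVertexState (Ambitwistor.opJ x 0 v) :=
  hv.map_of_commute (fun _ => commute_onBos_onCur _ _) (fun _ => commute_onFer_onCur _ _)
    fun y n => by
      rw [opJ_opJ, Nat.cast_add, Nat.cast_one, hv.opJ, map_zero, zero_add, add_zero, hv.opJ]

theorem map_fAnn (hv : IsVertexState v) (μ : Fin d) :
    IsVertexState (Ambitwistor.fAnn (.ψ μ 0) v) where
  bAnn i := map_mem_ker_of_commute (commute_onBos_onFer _ _) (hv.bAnn i)
  opJ x n := map_mem_ker_of_commute (commute_onFer_onCur _ _).symm (hv.opJ x n)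
  fAnn i h₁ h₂ h₃ := by rw [Ambitwistor.fAnn_fAnn, hv.fAnn i h₁ h₂ h₃, map_zero, neg_zero]
  fAnn_fAnn ν ξ := by rw [hv.fAnn_fAnn, map_zero]
  fCre_c := by rw [← neg_eq_zero, ← fAnn_fCre_of_ne _ (by simp), hv.fCre_c, map_zero]
  fCre_cbar := by rw [← neg_eq_zero, ← fAnn_fCre_of_ne _ (by simp), hv.fCre_cbar, map_zero]

theorem map_fCre_fAnn (hv : IsVertexState v) (μ ν : Fin d) :
    IsVertexState (fCre (.ψ μ 0) (Ambitwistor.fAnn (.ψ ν 0) v)) where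
  bAnn i := map_mem_ker_of_commute (commute_onBos_onFer _ _) ((hv.map_fAnn ν).bAnn i)
  opJ x n := map_mem_ker_of_commute (commute_onFer_onCur _ _).symm ((hv.map_fAnn ν).opJ x n)
  fAnn i h₁ h₂ h₃ := by
    rw [fAnn_fCre_of_ne _ (h₁ μ), (hv.map_fAnn ν).fAnn i h₁ h₂ h₃, map_zero, neg_zero]
  fAnn_fAnn ξ κ := by
    rw [fAnn_fCre, hv.fAnn_fAnn, map_zero, sub_zero, map_smul, hv.fAnn_fAnn, smul_zero]
  fCre_c := by rw [fCre_fCre, (hv.map_fAnn ν).fCre_c, map_zero, neg_zero]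
  fCre_cbar := by rw [fCre_fCre, (hv.map_fAnn ν).fCre_cbar, map_zero, neg_zero]

end IsVertexState

theorem hasTopMode_fFn_vertexSpace (f : SmoothFn d) :
    HasTopMode (vertexSpace 𝔤 d) (fFn f) (-1) (mulFn f) :=
  hasTopMode_fFn (fun _ hv _ _ => hv.bAnn _) fun _ hv => hv.map_onFn _

theorem hasTopMode_fX (μ : Fin d) :
    HasTopMode (vertexSpace 𝔤 d) (fX μ) (-1) (mulFn (coordFn μ)) where
  stable_bot := modeStable_bot.fX (by simp)
  map_mem _ hv := hv.map_onFn _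
  eq_top _ _ := rfl
  eq_zero n hn v hv := by
    lift n to ℕ using (by omega)
    exact hv.bAnn _

theorem hasTopMode_fPi (μ : Fin d) : HasTopMode (vertexSpace 𝔤 d) (fPi μ) 0 (-onFn (pd μ)) where
  stable_bot := modeStable_bot.fPi (by simp)
  map_mem _ hv := neg_mem (hv.map_onFn _)
  eq_top _ _ := rfl
  eq_zero
    | .ofNat (_ + 1), _, _, hv => neg_eq_zero.mpr (hv.bAnn _)

theorem hasTopMode_fJ (x : 𝔤) : HasTopMode (vertexSpace 𝔤 d) (fJ x) 0 (opJ x 0) where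
  stable_bot := modeStable_bot.fJ x
  map_mem _ hv := hv.map_opJ x
  eq_top _ _ := rfl
  eq_zero
    | .ofNat (n + 1), _, _, hv => hv.opJ x n

theorem hasTopMode_fPsi (μ : Fin d) :
    HasTopMode (vertexSpace 𝔤 d) (fPsi μ) 0 (eta μ • fAnn (.ψ μ 0)) where
  stable_bot := modeStable_bot.fPsi (by simp)
  map_mem v hv := Submodule.smul_mem _ (eta μ) (hv.map_fAnn μ)
  eq_top _ _ := rfl
  eq_zero
    | .ofNat (n + 1), _, v, hv => by
      change eta μ • fAnn (.ψ μ (n + 1)) v = 0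
      rw [hv.fAnn _ (by simp) (by simp) (by simp), smul_zero]

end VertexSpace

section CovariantDerivative

theorem pd_mul {d : ℕ} (μ : Fin d) (f g : SmoothFn d) :
    pd μ (f * g) = pd μ f * g + f * pd μ g := by
  apply Subtype.ext
  funext x
  change fderiv ℝ (f.1 * g.1) x (Pi.single μ 1) = _
  rw [fderiv_mul (f.differentiable x) (g.differentiable x)]
  change f.1 x * _ + g.1 x * _ = _ * g.1 x + f.1 x * _
  rw [add_comm, mul_comm (g.1 x)]
  rfl

variable {𝔤 ι : Type*} [LieRing 𝔤] [LieAlgebra ℝ 𝔤] {d : ℕ}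

theorem mulFn_mul (f g : SmoothFn d) :
    (mulFn (f * g) : Module.End ℂ (State 𝔤 d)) = mulFn f * mulFn g :=
  State.hom_ext fun h p w u => by
    simp only [Module.End.mul_apply, mulFn, onFn_tmul, LinearMap.mulLeft_apply, mul_assoc]

theorem onFn_pd_mul_mulFn (μ : Fin d) (f : SmoothFn d) :
    (onFn (pd μ) * mulFn f : Module.End ℂ (State 𝔤 d)) =
      mulFn (pd μ f) + mulFn f * onFn (pd μ) :=
  State.hom_ext fun g p w u => by
    simp only [Module.End.mul_apply, LinearMap.add_apply, mulFn, onFn_tmul,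
      LinearMap.mulLeft_apply, pd_mul, TensorProduct.add_tmul]

theorem commute_opJ_onFn (x : 𝔤) (n : ℤ) (T : Module.End ℂ (SmoothFn d)) :
    Commute (opJ x n) (onFn T) := (commute_onFn_onCur _ _).symm

variable [Fintype ι] (e : Module.Basis ι ℝ 𝔤)

/-- The operator `F^a j^a_(0)`, the adjoint action of a multiplet `F` of functions. -/
def adOp (F : ι → SmoothFn d) : Module.End ℂ (State 𝔤 d) := ∑ a, mulFn (F a) * opJ (e a) 0

/-- The gauge-covariant derivative `∂_μ + A_μ^a j^a_(0)` as an operator on states. -/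
def covOp (A : Fin d → ι → SmoothFn d) (μ : Fin d) : Module.End ℂ (State 𝔤 d) :=
  onFn (pd μ) + adOp e (A μ)

theorem onFn_pd_mul_adOp (μ : Fin d) (F : ι → SmoothFn d) :
    onFn (pd μ) * adOp e F = adOp e (fun a => pd μ (F a)) + adOp e F * onFn (pd μ) := by
  simp only [adOp, Finset.mul_sum, Finset.sum_mul, ← Finset.sum_add_distrib]
  refine Finset.sum_congr rfl fun a _ => ?_
  rw [← mul_assoc, onFn_pd_mul_mulFn, add_mul, mul_assoc, mul_assoc, (commute_opJ_onFn ..).eq]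

theorem adOp_mul_adOp_self (F : ι → SmoothFn d) :
    adOp e F * adOp e F =
      ∑ a, ∑ b, mulFn (F a * F b) * (opJ (e b) 0 * opJ (e a) 0) := by
  simp only [adOp, Finset.mul_sum, Finset.sum_mul]
  refine Finset.sum_congr rfl fun a _ => Finset.sum_congr rfl fun b _ => ?_
  have comm : opJ (e b) 0 * mulFn (F a) = mulFn (F a) * opJ (e b) 0 := commute_opJ_onFn ..
  rw [mul_comm (F a), mulFn_mul, mul_assoc, mul_assoc, ← mul_assoc (opJ _ _), comm, mul_assoc]

theorem covOp_mul_covOp (A : Fin d → ι → SmoothFn d) (μ : Fin d) :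
    covOp e A μ * covOp e A μ = onFn (pd μ) * onFn (pd μ) + (2 : ℂ) • (adOp e (A μ) * onFn (pd μ))
      + adOp e (A μ) * adOp e (A μ) + adOp e fun a => pd μ (A μ a) := by
  rw [covOp, add_mul, mul_add, mul_add, onFn_pd_mul_adOp, two_smul]
  abel

end CovariantDerivative

theorem eta_mul_self {d : ℕ} (μ : Fin d) : eta μ * eta μ = 1 := by
  rw [eta]
  split_ifs <;> norm_num

section Currents

variable {𝔤 : Type*} [LieRing 𝔤] [LieAlgebra ℝ 𝔤] {d : ℕ}

theorem fPsi_smul_fAnn_eq_zero (μ ν : Fin d) {n : ℤ} (hn : 0 ≤ n) {v : State 𝔤 d}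
    (hv : IsVertexState v) : fPsi ν n ((eta μ • fAnn (.ψ μ 0)) v) = 0 := by
  have hv' := (hasTopMode_fPsi μ).map_mem v hv
  rcases hn.eq_or_lt with rfl | hn
  · rw [(hasTopMode_fPsi ν).eq_top _ hv', LinearMap.smul_apply, LinearMap.smul_apply, map_smul,
      hv.fAnn_fAnn, smul_zero, smul_zero]
  · exact (hasTopMode_fPsi ν).eq_zero _ hn _ hv'

theorem hasTopMode_nopF_fPsi_fPsi (μ ν : Fin d) :
    HasTopMode (vertexSpace 𝔤 d) (nopF (fPsi μ) (fPsi ν)) 0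
      (eta ν • (fCre (.ψ μ 0) * fAnn (.ψ ν 0)) - eta μ • (fCre (.ψ ν 0) * fAnn (.ψ μ 0))) where
  stable_bot := (hasTopMode_fPsi μ).stable_bot.nopF (hasTopMode_fPsi ν).stable_bot
  map_mem v hv := sub_mem (Submodule.smul_mem _ (eta ν) (hv.map_fCre_fAnn μ ν))
    (Submodule.smul_mem _ (eta μ) (hv.map_fCre_fAnn ν μ))
  eq_top v hv := by
    rw [nopF, (hasTopMode_fPsi μ).nopSign_of_top_zero _ (hasTopMode_fPsi ν) le_rfl hv]
    change fCre (.ψ μ 0) (eta ν • fAnn (.ψ ν 0) v)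
      + (-1 : ℂ) • fCre (.ψ ν 0) (eta μ • fAnn (.ψ μ 0) v) = _
    simp [sub_eq_add_neg]
  eq_zero n hn v hv := by
    rw [nopF, (hasTopMode_fPsi μ).nopSign_of_top_zero _ (hasTopMode_fPsi ν) hn.le hv,
      (hasTopMode_fPsi ν).eq_zero n hn v hv, (hasTopMode_fPsi μ).stable_bot.map_zero, zero_add,
      fPsi_smul_fAnn_eq_zero μ ν (by omega) hv, smul_zero]

theorem hasTopMode_nopF_fPsi_del_fPsi (μ : Fin d) :
    HasTopMode (vertexSpace 𝔤 d) (nopF (fPsi μ) (del (fPsi μ))) 1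
      (-eta μ • (fCre (.ψ μ 0) * fAnn (.ψ μ 0))) := by
  have one_term {n : ℤ} (hn : 1 ≤ n) {v : State 𝔤 d} (hv : IsVertexState v) :
      nopF (fPsi μ) (del (fPsi μ)) n v = fPsi μ (-1) (del (fPsi μ) n v) := by
    rw [nopF, (hasTopMode_fPsi μ).nopSign_of_top_zero _ (hasTopMode_fPsi μ).del hn hv]
    suffices del (fPsi μ) (n - 1) ((eta μ • fAnn (.ψ μ 0)) v) = 0 by rw [this, smul_zero, add_zero]
    rcases hn.eq_or_lt with rfl | hn
    · simp [del]
    · rw [del, fPsi_smul_fAnn_eq_zero μ μ (by omega) hv, smul_zero]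
  refine ⟨(hasTopMode_fPsi μ).stable_bot.nopF (hasTopMode_fPsi μ).stable_bot.del,
    fun v hv => Submodule.smul_mem _ (-eta μ) (hv.map_fCre_fAnn μ μ), fun v hv => ?_,
    fun n hn v hv => ?_⟩
  · have eq_top : del (fPsi μ) 1 v = _ := (hasTopMode_fPsi μ).del.eq_top v hv
    rw [one_term le_rfl hv, eq_top]
    change fCre (.ψ μ 0) (-(((0 : ℤ) : ℂ) + 1) • eta μ • fAnn (.ψ μ 0) v) = _
    simp
  · rw [one_term hn.le hv, (hasTopMode_fPsi μ).del.eq_zero n hn v hv,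
      (hasTopMode_fPsi μ).stable_bot.map_zero]

/-- On the subspace `S` the lowest mode `Φ_(-1)` of the ghost field `Φ` is filled, and the mode
`Ψ_(0)` of its conjugate field `Ψ` empties it. -/
structure IsFilledGhost (S : Submodule ℂ (State 𝔤 d)) (Φ Ψ : WField 𝔤 d) : Prop where
  hasTopMode : HasTopMode S Φ (-1) 0
  stable_bot : Stable ⊥ Ψ
  eq_zero : ∀ n > 0, ∀ v ∈ S, Ψ n v = 0
  refill (s : ℂ) : ∀ v ∈ S, Φ (-1) (s • Ψ 0 v) = s • v
  apply_eq_zero : ∀ n ≥ 0, ∀ v ∈ S, Φ n (Ψ 0 v) = 0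

namespace IsFilledGhost

variable {S : Submodule ℂ (State 𝔤 d)} {Φ Ψ : WField 𝔤 d}

theorem nopSign_del (h : IsFilledGhost S Φ Ψ) (s : ℂ) :
    HasTopMode S (nopSign s Φ (del Ψ)) 1 (-1) := by
  have one_term {n : ℤ} (hn : 1 ≤ n) {v : State 𝔤 d} (hv : v ∈ S) :
      Ambitwistor.nopSign s Φ (del Ψ) n v = Φ (-1) (-(n : ℂ) • Ψ (n - 1) v) := by
    have del_eq_zero : ∀ k > n, del Ψ k v = 0 := fun k hk => by
      rw [del, h.eq_zero _ (by omega) v hv, smul_zero]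
    rw [nopSign_eq_add _ h.hasTopMode.stable_bot h.stable_bot.del del_eq_zero
      fun m hm => h.hasTopMode.eq_zero m (by omega) v hv, h.hasTopMode.eq_zero 0 (by decide) v hv,
      h.stable_bot.del.map_zero, smul_zero, add_zero, del]
  refine ⟨h.hasTopMode.stable_bot.nopSign s h.stable_bot.del, fun v hv => neg_mem hv,
    fun v hv => ?_, fun n hn v hv => ?_⟩
  · rw [one_term le_rfl hv, sub_self, h.refill _ v hv]
    simp
  · rw [one_term (by omega) hv, h.eq_zero _ (by omega) v hv, smul_zero,
      h.hasTopMode.stable_bot.map_zero]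

theorem nopSign_swap_del (h : IsFilledGhost S Φ Ψ) (s : ℂ) :
    HasTopMode S (nopSign s Ψ (del Φ)) 1 0 := by
  have eq_zero {n : ℤ} (hn : 1 ≤ n) {v : State 𝔤 d} (hv : v ∈ S) :
      Ambitwistor.nopSign s Ψ (del Φ) n v = 0 := by
    have del_eq_zero : ∀ k ≥ 0, del Φ k v = 0 := fun k hk => by
      rcases hk.eq_or_lt with rfl | hk
      · simp [del]
      · rw [del, h.hasTopMode.eq_zero _ (by omega) v hv, smul_zero]
    have del_apply : del Φ (n - 1) (Ψ 0 v) = 0 := by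
      rcases hn.eq_or_lt with rfl | hn
      · simp [del]
      · rw [del, h.apply_eq_zero _ (by omega) v hv, smul_zero]
    rw [nopSign_eq_add _ h.stable_bot h.hasTopMode.stable_bot.del
      (fun k hk => del_eq_zero k (by omega)) fun m hm => h.eq_zero m hm v hv,
      del_eq_zero n (by omega), h.stable_bot.map_zero, del_apply, smul_zero, add_zero]
  exact ⟨h.stable_bot.nopSign s h.hasTopMode.stable_bot.del, fun _ _ => zero_mem _,
    fun v hv => eq_zero le_rfl hv, fun n hn v hv => eq_zero hn.le hv⟩

end IsFilledGhost

theorem isFilledGhost_fC : IsFilledGhost (vertexSpace 𝔤 d) fC fB where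
  hasTopMode :=
    { stable_bot := modeStable_bot.fC (by simp)
      map_mem := fun _ _ => zero_mem _
      eq_top := fun _ hv => hv.fCre_c
      eq_zero := fun n hn v hv => by
        lift n to ℕ using (by omega)
        exact hv.fAnn _ (by simp) (by simp) (by simp) }
  stable_bot := modeStable_bot.fB (by simp)
  eq_zero
    | .ofNat (n + 1), _, v, hv => hv.fAnn _ (by simp) (by simp) (by simp)
  refill s v hv := by
    change fCre (.c 0) (s • fAnn (.c 0) v) = s • v
    rw [map_smul, ← sub_sub_self v (fCre _ _), ← fAnn_fCre_self, hv.fCre_c, map_zero, sub_zero]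
  apply_eq_zero n hn v hv := by
    lift n to ℕ using hn
    change fAnn (.b n) (fAnn (.c 0) v) = 0
    rw [fAnn_fAnn, hv.fAnn _ (by simp) (by simp) (by simp), map_zero, neg_zero]

theorem isFilledGhost_fCbar : IsFilledGhost (vertexSpace 𝔤 d) fCbar fBbar where
  hasTopMode :=
    { stable_bot := modeStable_bot.fCbar (by simp)
      map_mem := fun _ _ => zero_mem _
      eq_top := fun _ hv => hv.fCre_cbar
      eq_zero := fun n hn v hv => by
        lift n to ℕ using (by omega)
        exact hv.fAnn _ (by simp) (by simp) (by simp) }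
  stable_bot := modeStable_bot.fBbar (by simp)
  eq_zero
    | .ofNat (n + 1), _, v, hv => hv.fAnn _ (by simp) (by simp) (by simp)
  refill s v hv := by
    change fCre (.cbar 0) (s • fAnn (.cbar 0) v) = s • v
    rw [map_smul, ← sub_sub_self v (fCre _ _), ← fAnn_fCre_self, hv.fCre_cbar, map_zero, sub_zero]
  apply_eq_zero n hn v hv := by
    lift n to ℕ using hn
    change fAnn (.bbar n) (fAnn (.cbar 0) v) = 0
    rw [fAnn_fAnn, hv.fAnn _ (by simp) (by simp) (by simp), map_zero, neg_zero]

theorem hasTopMode_fGamma {S : Submodule ℂ (State 𝔤 d)} (h : ∀ v ∈ S, ∀ k, bAnn (.β k) v = 0) :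
    HasTopMode S fGamma (-1) 0 where
  stable_bot := modeStable_bot.fGamma (by simp)
  map_mem _ _ := zero_mem _
  eq_top v hv := h v hv 0
  eq_zero n hn v hv := by
    lift n to ℕ using (by omega)
    exact h v hv _

theorem isFilledGhost_fGamma : IsFilledGhost (vertexSpace 𝔤 d) fGamma fBeta where
  hasTopMode := hasTopMode_fGamma fun _ hv _ => hv.bAnn _
  stable_bot := modeStable_bot.fBeta (by simp)
  eq_zero
    | .ofNat (n + 1), _, v, hv => neg_eq_zero.mpr (hv.bAnn _)
  refill s v hv := by
    change bAnn (.β 0) (s • bCre (.β 0) v) = s • v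
    rw [map_smul, bAnn_bCre_self, hv.bAnn, map_zero, add_zero]
  apply_eq_zero n hn v hv := by
    lift n to ℕ using hn
    change bAnn (.β (n + 1)) (bCre (.β 0) v) = 0
    rw [bAnn_bCre_of_ne _ (by simp), hv.bAnn, map_zero]

variable {ι : Type*} [Fintype ι] (e : Module.Basis ι ℝ 𝔤)

theorem hasTopMode_fFn_fJ (f : SmoothFn d) (x : 𝔤) :
    HasTopMode (vertexSpace 𝔤 d) (nop (fFn f) (fJ x)) 0 (mulFn f * opJ x 0) :=
  (hasTopMode_fFn_vertexSpace f).nop_of_top_neg_one (hasTopMode_fJ x)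

theorem hasTopMode_curG (A : Fin d → ι → SmoothFn d) :
    HasTopMode (vertexSpace 𝔤 d) (curG e A) 1
      (∑ μ, -covOp e A μ * (eta μ • fAnn (.ψ μ 0))) :=
  .sum fun μ => (hasTopMode_fPsi μ).nop_of_top_zero (U := -covOp e A μ) <| by
    rw [covOp, neg_add']
    exact (hasTopMode_fPi μ).sub (.sum fun a => hasTopMode_fFn_fJ _ _)

theorem hasTopMode_stressT (C : ℝ) :
    HasTopMode (vertexSpace 𝔤 d) (stressT e C) 1
      ((1 / 2 : ℂ) • ∑ μ, fCre (.ψ μ 0) * fAnn (.ψ μ 0)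
        - (C : ℂ)⁻¹ • ∑ a, opJ (e a) 0 * opJ (e a) 0 - (1 / 2 : ℂ) • 1) := by
  have Pi_dX (μ : Fin d) : HasTopMode (vertexSpace 𝔤 d) (nop (fPi μ) (del (fX μ))) 1 _ :=
    (hasTopMode_fPi μ).nop_of_top_zero (hasTopMode_fX μ).del
  have psi_dpsi (μ : Fin d) := (hasTopMode_nopF_fPsi_del_fPsi (𝔤 := 𝔤) μ).smul (eta μ)
  have jj (a : ι) : HasTopMode (vertexSpace 𝔤 d) (nop (fJ (e a)) (fJ (e a))) 1 _ :=
    (hasTopMode_fJ (e a)).nop_of_top_zero (hasTopMode_fJ (e a))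
  have cb := isFilledGhost_fCbar (𝔤 := 𝔤) (d := d)
  have γβ := isFilledGhost_fGamma (𝔤 := 𝔤) (d := d)
  refine (((((HasTopMode.sum Pi_dX).neg.sub ((HasTopMode.sum psi_dpsi).smul _)).sub
    ((HasTopMode.sum jj).smul _)).add
    ((cb.nopSign_del (-1)).sub ((cb.nopSign_swap_del (-1)).smul 2))).add
    (((γβ.nopSign_swap_del 1).smul (3 / 2)).neg.sub ((γβ.nopSign_del 1).smul (1 / 2)))).congr ?_
  simp only [Int.cast_neg, Int.cast_one, neg_add_cancel, neg_zero, zero_smul, zero_mul,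
    Finset.sum_const_zero, smul_smul, mul_neg, eta_mul_self, neg_smul, one_smul,
    Finset.sum_neg_distrib, smul_neg, smul_zero]
  module

theorem hasTopMode_curH (A : Fin d → ι → SmoothFn d) :
    HasTopMode (vertexSpace 𝔤 d) (curH e A) 1
      (∑ μ, eta μ • (covOp e A μ * covOp e A μ)
        + ∑ μ, ∑ ν, adOp e (fieldStrength e A μ ν) *
          (eta ν • (fCre (.ψ μ 0) * fAnn (.ψ ν 0)) - eta μ • (fCre (.ψ ν 0) * fAnn (.ψ μ 0)))) := by
  have PiPi (μ : Fin d) : HasTopMode (vertexSpace 𝔤 d) (nop (fPi μ) (fPi μ)) 1 _ :=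
    (hasTopMode_fPi μ).nop_of_top_zero (hasTopMode_fPi μ)
  have PiAj (μ : Fin d) (a : ι) :
      HasTopMode (vertexSpace 𝔤 d) (nop (fPi μ) (nop (fFn (A μ a)) (fJ (e a)))) 1 _ :=
    (hasTopMode_fPi μ).nop_of_top_zero (hasTopMode_fFn_fJ (A μ a) (e a))
  have AAjj (μ : Fin d) (a b : ι) : HasTopMode (vertexSpace 𝔤 d)
      (nop (fFn (A μ a * A μ b)) (nop (fJ (e a)) (fJ (e b)))) 1 _ :=
    (hasTopMode_fFn_vertexSpace _).nop_of_top_neg_one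
      ((hasTopMode_fJ (e a)).nop_of_top_zero (hasTopMode_fJ (e b)))
  have psipsiFj (μ ν : Fin d) (a : ι) : HasTopMode (vertexSpace 𝔤 d)
      (nop (nopF (fPsi μ) (fPsi ν)) (nop (fFn (fieldStrength e A μ ν a)) (fJ (e a)))) 1 _ :=
    (hasTopMode_nopF_fPsi_fPsi μ ν).nop_of_top_zero (hasTopMode_fFn_fJ _ _)
  have dAj (μ : Fin d) (a : ι) :
      HasTopMode (vertexSpace 𝔤 d) (nop (fFn (pd μ (A μ a))) (fJ (e a))) 0 _ :=
    hasTopMode_fFn_fJ _ _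
  have jAdA (μ : Fin d) (a b c : ι) : HasTopMode (vertexSpace 𝔤 d)
      (nop (fJ (e c)) (nop (fFn (A μ b)) (del (fFn (A μ a))))) 1 _ :=
    (hasTopMode_fJ (e c)).nop_of_top_zero
      ((hasTopMode_fFn_vertexSpace _).nop_of_top_neg_one (hasTopMode_fFn_vertexSpace _).del)
  refine (((((((HasTopMode.sum fun μ => (PiPi μ).smul (eta μ)).sub
      ((HasTopMode.sum fun μ => (HasTopMode.sum (PiAj μ)).smul (eta μ)).smul 2)).add
    (.sum fun μ => (HasTopMode.sum fun a => .sum (AAjj μ a)).smul (eta μ))).add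
    (.sum fun μ => .sum fun ν => .sum (psipsiFj μ ν))).sub
    (HasTopMode.sum fun μ => (HasTopMode.sum (dAj μ)).smul (eta μ)).del).add
    (.sum fun a => .sum fun b => .sum fun c =>
      (HasTopMode.sum fun μ => (jAdA μ a b c).smul (eta μ)).smul (structConst e a b c)))).congr
    (LinearMap.ext fun v => ?_)
  simp only [covOp_mul_covOp, adOp_mul_adOp_self]
  simp only [adOp, Int.cast_neg, Int.cast_one, Int.cast_zero, neg_add_cancel, neg_zero, zero_smul,
    zero_add, one_smul, neg_smul, mul_zero, smul_zero, zero_mul, Finset.sum_const_zero, add_zero,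
    Module.End.mul_apply, LinearMap.add_apply, LinearMap.sub_apply, LinearMap.neg_apply,
    LinearMap.smul_apply, LinearMap.sum_apply, map_neg, neg_neg, Finset.smul_sum,
    Finset.sum_neg_distrib, smul_neg, smul_add, Finset.sum_add_distrib, smul_comm (2 : ℂ)]
  abel

end Currents

section StructureConstants

variable {𝔤 ι : Type*} [LieRing 𝔤] [LieAlgebra ℝ 𝔤] (e : Module.Basis ι ℝ 𝔤)

theorem structConst_antisymm (a b c : ι) : structConst e a b c = -structConst e b a c := by
  rw [structConst, structConst, ← lie_skew, map_neg, Finsupp.neg_apply, Complex.ofReal_neg]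

section Killing

variable [DecidableEq ι] {C : ℝ} {e}

theorem killingForm_basis_right
    (he : ∀ a b, killingForm ℝ 𝔤 (e a) (e b) = if a = b then -C else 0) (x : 𝔤) (c : ι) :
    killingForm ℝ 𝔤 x (e c) = -C * e.repr x c := by
  have on_basis : (killingForm ℝ 𝔤).flip (e c) = -C • e.coord c := e.ext fun a => by
    simp [he, Finsupp.single_apply]
  exact LinearMap.congr_fun on_basis x

theorem structConst_cyclic (hC : C ≠ 0)
    (he : ∀ a b, killingForm ℝ 𝔤 (e a) (e b) = if a = b then -C else 0) (a b c : ι) :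
    structConst e a b c = structConst e b c a := by
  have invariance : killingForm ℝ 𝔤 ⁅e a, e b⁆ (e c) = killingForm ℝ 𝔤 (e a) ⁅e b, e c⁆ :=
    LieModule.traceForm_apply_lie_apply ℝ 𝔤 𝔤 (e a) (e b) (e c)
  have symmetry : killingForm ℝ 𝔤 (e a) ⁅e b, e c⁆ = killingForm ℝ 𝔤 ⁅e b, e c⁆ (e a) :=
    LieModule.traceForm_comm ℝ 𝔤 𝔤 _ _
  rw [symmetry, killingForm_basis_right he, killingForm_basis_right he] at invariance
  rw [structConst, structConst, mul_left_cancel₀ (neg_ne_zero.mpr hC) invariance]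

end Killing

variable [Fintype ι]

theorem opJ_lie {d : ℕ} (a b : ι) (n : ℤ) (v : State 𝔤 d) :
    opJ ⁅e a, e b⁆ n v = ∑ c, structConst e a b c • opJ (e c) n v := by
  conv_lhs => rw [← e.sum_repr ⁅e a, e b⁆, opJ_sum]
  rfl

theorem sum_structConst_mul_swap (a b : ι) :
    ∑ c, ∑ k, structConst e a k c * structConst e b c k = (killingForm ℝ 𝔤 (e a) (e b) : ℂ) := by
  classical
  rw [killingForm_apply_apply, LinearMap.trace_eq_matrix_trace ℝ e, Matrix.trace]
  simp only [LinearMap.toMatrix_comp e e e, Matrix.diag_apply, Matrix.mul_apply,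
    LinearMap.toMatrix_apply, LieAlgebra.ad_apply, Complex.ofReal_sum, Complex.ofReal_mul]
  rfl

theorem sum_structConst_mul [DecidableEq ι] {C : ℝ} {e : Module.Basis ι ℝ 𝔤} (hC : C ≠ 0)
    (he : ∀ a b, killingForm ℝ 𝔤 (e a) (e b) = if a = b then -C else 0) (a b : ι) :
    ∑ c, ∑ k, structConst e a c k * structConst e b c k = if a = b then (C : ℂ) else 0 := by
  have swap (c k : ι) : structConst e a c k = -structConst e a k c := by
    rw [structConst_cyclic hC he a c k, structConst_antisymm, ← structConst_cyclic hC he a k c]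
  calc ∑ c, ∑ k, structConst e a c k * structConst e b c k
      = -∑ c, ∑ k, structConst e a k c * structConst e b c k := by
        simp only [← Finset.sum_neg_distrib, ← neg_mul]
        exact Finset.sum_congr rfl fun c _ => Finset.sum_congr rfl fun k _ => by rw [swap]
    _ = if a = b then (C : ℂ) else 0 := by
        rw [sum_structConst_mul_swap, he]
        split_ifs <;> simp

end StructureConstants

section Multiplets

variable {𝔤 ι : Type*} [LieRing 𝔤] [LieAlgebra ℝ 𝔤] [Fintype ι] (e : Module.Basis ι ℝ 𝔤) {d : ℕ}

theorem bAnn_fnState (i : BMode d) (f : SmoothFn d) : bAnn i (fnState 𝔤 f) = 0 := by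
  rw [fnState, bAnn, onBos_tmul, Derivation.coeFn_coe, Derivation.map_one_eq_zero,
    TensorProduct.zero_tmul, TensorProduct.tmul_zero]

theorem fAnn_fnState (i : FMode d) (f : SmoothFn d) : fAnn i (fnState 𝔤 f) = 0 := by
  rw [fnState, fAnn, onFer_tmul, CliffordAlgebra.contractLeft_one, TensorProduct.zero_tmul,
    TensorProduct.tmul_zero, TensorProduct.tmul_zero]

/-- The state `u^a j^a δ(γ)` of a multiplet `u` of functions. -/
def multiplet : (ι → SmoothFn d) →ₗ[ℂ] State 𝔤 d :=
  ∑ i, opJ (e i) (-1) ∘ₗ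
    (TensorProduct.mk ℂ _ _).flip ((1 : Bos d) ⊗ₜ[ℂ] ((1 : Fer d) ⊗ₜ[ℂ] curVac 𝔤)) ∘ₗ
    LinearMap.proj i

theorem multiplet_apply (u : ι → SmoothFn d) :
    multiplet e u = ∑ i, opJ (e i) (-1) (fnState 𝔤 (u i)) := by
  simp only [multiplet, LinearMap.sum_apply]
  rfl

variable (u : ι → SmoothFn d)

theorem bAnn_multiplet (i : BMode d) : bAnn i (multiplet e u) = 0 := by
  rw [multiplet_apply]
  exact (LinearMap.ker (bAnn i)).sum_mem fun j _ =>
    map_mem_ker_of_commute (commute_onBos_onCur _ _) (bAnn_fnState i _)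

theorem fAnn_multiplet (i : FMode d) : fAnn i (multiplet e u) = 0 := by
  rw [multiplet_apply]
  exact (LinearMap.ker (fAnn i)).sum_mem fun j _ =>
    map_mem_ker_of_commute (commute_onFer_onCur _ _) (fAnn_fnState i _)

theorem opJ_natCast_add_one_multiplet (x : 𝔤) (n : ℕ) : opJ x (n + 1) (multiplet e u) = 0 := by
  rw [multiplet_apply, map_sum]
  refine Finset.sum_eq_zero fun i _ => ?_
  have annihilated := opJ_natCast_fnState x (n + 1) (u i)
  rw [Nat.cast_add_one] at annihilated
  rw [opJ_opJ, annihilated, map_zero, zero_add, add_neg_cancel_right, opJ_natCast_fnState]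

theorem onFn_multiplet (T : Module.End ℂ (SmoothFn d)) :
    onFn T (multiplet e u) = multiplet e fun i => T (u i) := by
  simp only [multiplet_apply, map_sum]
  refine Finset.sum_congr rfl fun i _ => ?_
  rw [← Module.End.mul_apply, ← (commute_opJ_onFn ..).eq, Module.End.mul_apply, fnState, onFn_tmul]
  rfl

/-- The bracket `f^{abc} F^b u^c` of two multiplets of functions. -/
def adMul (F u : ι → SmoothFn d) : ι → SmoothFn d :=
  fun a => ∑ b, ∑ c, structConst e a b c • (F b * u c)

theorem covD_eq (A : Fin d → ι → SmoothFn d) (μ : Fin d) :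
    covD e A μ u = (fun i => pd μ (u i)) + adMul e (A μ) u := rfl

theorem fieldStrength_eq (A : Fin d → ι → SmoothFn d) (μ ν : Fin d) :
    fieldStrength e A μ ν =
      (fun a => pd μ (A ν a)) - (fun a => pd ν (A μ a)) + adMul e (A μ) (A ν) := rfl

theorem adMul_neg (F : ι → SmoothFn d) : adMul e F (-u) = -adMul e F u := by
  funext a
  simp only [adMul, Pi.neg_apply, ← Finset.sum_neg_distrib, ← smul_neg]
  exact Finset.sum_congr rfl fun b _ => Finset.sum_congr rfl fun c _ =>
    congrArg _ (mul_neg (F b) (u c))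

theorem linYM_eq (A a : Fin d → ι → SmoothFn d) (ν : Fin d) :
    linYM e A a ν = ∑ μ, eta μ • covD e A μ (covD e A μ (a ν)) +
      (2 : ℂ) • ∑ μ, eta μ • adMul e (a μ) (fieldStrength e A μ ν) := by
  funext i
  simp only [linYM, Pi.add_apply, Finset.sum_apply, Pi.smul_apply, adMul, Finset.smul_sum]
  congr 1
  conv_rhs => rw [Finset.sum_comm]
  refine Finset.sum_congr rfl fun b _ => ?_
  conv_rhs => rw [Finset.sum_comm]
  refine Finset.sum_congr rfl fun c _ => Finset.sum_congr rfl fun μ _ => ?_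
  rw [smul_comm (eta μ)]

section Cyclic

variable {e} {u} (hcyc : ∀ a b c, structConst e a b c = structConst e b c a)

include hcyc

theorem adMul_antisymm (F : ι → SmoothFn d) : adMul e F u = -adMul e u F := by
  funext a
  rw [Pi.neg_apply, adMul, adMul, ← Finset.sum_neg_distrib, Finset.sum_comm]
  refine Finset.sum_congr rfl fun b _ => ?_
  rw [← Finset.sum_neg_distrib]
  refine Finset.sum_congr rfl fun c _ => ?_
  rw [← hcyc b a c, structConst_antisymm e b a c, neg_smul, mul_comm]

theorem fieldStrength_antisymm (A : Fin d → ι → SmoothFn d) (μ ν : Fin d) :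
    fieldStrength e A μ ν = -fieldStrength e A ν μ := by
  rw [fieldStrength_eq, fieldStrength_eq, adMul_antisymm hcyc]
  abel

theorem adMul_fieldStrength (A : Fin d → ι → SmoothFn d) (μ ν : Fin d) :
    adMul e (fieldStrength e A μ ν) u = adMul e u (fieldStrength e A ν μ) := by
  rw [adMul_antisymm hcyc, fieldStrength_antisymm hcyc A μ ν, adMul_neg, neg_neg]

theorem opJ_zero_multiplet (b : ι) :
    opJ (e b) 0 (multiplet e u) = multiplet e fun a => ∑ c, structConst e a b c • u c := by
  have annihilated (x : 𝔤) (f : SmoothFn d) : opJ x 0 (fnState 𝔤 f) = 0 :=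
    opJ_natCast_fnState x 0 f
  have map_fnState (s : ι → ℂ) : fnState 𝔤 (∑ c, s c • u c) = ∑ c, s c • fnState 𝔤 (u c) := by
    simp only [fnState, TensorProduct.sum_tmul, TensorProduct.smul_tmul']
  simp only [multiplet_apply, map_sum, opJ_opJ _ (e b), annihilated, map_zero, zero_add, opJ_lie,
    map_fnState, map_smul]
  rw [Finset.sum_comm]
  simp only [hcyc _ b]

theorem adOp_multiplet (F : ι → SmoothFn d) :
    adOp e F (multiplet e u) = multiplet e (adMul e F u) := by
  simp only [adOp, LinearMap.sum_apply, Module.End.mul_apply, opJ_zero_multiplet hcyc, mulFn,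
    onFn_multiplet, ← map_sum]
  congr 1
  funext a
  simp only [Finset.sum_apply, adMul, LinearMap.mulLeft_apply, Finset.mul_sum, mul_smul_comm]

theorem covOp_multiplet (A : Fin d → ι → SmoothFn d) (μ : Fin d) :
    covOp e A μ (multiplet e u) = multiplet e (covD e A μ u) := by
  rw [covOp, LinearMap.add_apply, adOp_multiplet hcyc, onFn_multiplet, covD_eq, map_add]

theorem casimir_multiplet [DecidableEq ι] {C : ℂ}
    (hC : ∀ a b, ∑ c, ∑ k, structConst e a c k * structConst e b c k = if a = b then C else 0) :
    ∑ a, opJ (e a) 0 (opJ (e a) 0 (multiplet e u)) = -C • multiplet e u := by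
  have swap (c a i : ι) : structConst e c a i = -structConst e i a c := by
    rw [structConst_antisymm, hcyc a c i, hcyc c i a]
  simp only [opJ_zero_multiplet hcyc, ← map_sum, ← map_smul]
  congr 1
  funext k
  calc _ = -∑ a, ∑ c, ∑ i, (structConst e k a c * structConst e i a c) • u i := by
        simp only [Finset.sum_apply, Finset.smul_sum, smul_smul, ← Finset.sum_neg_distrib,
          ← neg_smul]
        refine Finset.sum_congr rfl fun a _ => Finset.sum_congr rfl fun c _ =>
          Finset.sum_congr rfl fun i _ => ?_
        rw [swap c a i, mul_neg]
    _ = -∑ i, (∑ a, ∑ c, structConst e k a c * structConst e i a c) • u i := by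
        simp only [Finset.sum_smul]
        conv_rhs => rw [Finset.sum_comm]
        exact congrArg _ (Finset.sum_congr rfl fun a _ => Finset.sum_comm)
    _ = -C • u k := by
        simp only [hC, ite_smul, zero_smul, Finset.sum_ite_eq, Finset.mem_univ, if_true, neg_smul]

end Cyclic

end Multiplets

section GluonVertex

variable {𝔤 : Type*} [LieRing 𝔤] [LieAlgebra ℝ 𝔤] {d : ℕ}

variable (𝔤 d) in
/-- The ghost prefactor `c c̄` of a fixed vertex operator. -/
def ccbar : Module.End ℂ (State 𝔤 d) := fCre (.c 0) * fCre (.cbar 0)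

theorem fCre_ccbar (i : FMode d) (v : State 𝔤 d) :
    fCre i (ccbar 𝔤 d v) = ccbar 𝔤 d (fCre i v) := by
  rw [ccbar, Module.End.mul_apply, Module.End.mul_apply, fCre_fCre, fCre_fCre _ i, map_neg,
    neg_neg]

theorem fAnn_ccbar {i : FMode d} (h₁ : i ≠ .c 0) (h₂ : i ≠ .cbar 0) (v : State 𝔤 d) :
    fAnn i (ccbar 𝔤 d v) = ccbar 𝔤 d (fAnn i v) := by
  rw [ccbar, Module.End.mul_apply, Module.End.mul_apply, fAnn_fCre_of_ne _ h₁,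
    fAnn_fCre_of_ne _ h₂, map_neg, neg_neg]

theorem fCre_c_ccbar (v : State 𝔤 d) : fCre (.c 0) (ccbar 𝔤 d v) = 0 := fCre_self _ _

theorem fCre_cbar_ccbar (v : State 𝔤 d) : fCre (.cbar 0) (ccbar 𝔤 d v) = 0 := by
  rw [ccbar, Module.End.mul_apply, fCre_fCre, fCre_self, map_zero, neg_zero]

variable {ι : Type*} [Fintype ι] (e : Module.Basis ι ℝ 𝔤)

/-- The state `c c̄ δ(γ) ψ^ν u^a j^a` of a multiplet `u` of functions. -/
def gluonState (ν : Fin d) : (ι → SmoothFn d) →ₗ[ℂ] State 𝔤 d :=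
  ccbar 𝔤 d ∘ₗ fCre (.ψ ν 0) ∘ₗ multiplet e

theorem gluonState_apply (ν : Fin d) (u : ι → SmoothFn d) :
    gluonState e ν u = ccbar 𝔤 d (fCre (.ψ ν 0) (multiplet e u)) := rfl

theorem gluonV_eq (a : Fin d → ι → SmoothFn d) : gluonV e a = ∑ ν, gluonState e ν (a ν) := by
  simp only [gluonState, LinearMap.comp_apply, multiplet_apply, map_sum]
  rfl

theorem apply_ccbar_fCre {T : Module.End ℂ (State 𝔤 d)} (hT : ∀ i, Commute T (fCre i))
    (i : FMode d) (v : State 𝔤 d) :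
    T (ccbar 𝔤 d (fCre i v)) = ccbar 𝔤 d (fCre i (T v)) :=
  LinearMap.congr_fun (((hT _).mul_right (hT _)).mul_right (hT i)).eq v

theorem opJ_ccbar_fCre (x : 𝔤) (n : ℤ) (i : FMode d) (v : State 𝔤 d) :
    opJ x n (ccbar 𝔤 d (fCre i v)) = ccbar 𝔤 d (fCre i (opJ x n v)) :=
  apply_ccbar_fCre (fun _ => (commute_onFer_onCur ..).symm) i v

theorem fAnn_gluonState {i : FMode d} (hψ : ∀ μ, i ≠ .ψ μ 0) (hc : i ≠ .c 0) (hcbar : i ≠ .cbar 0)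
    (ν : Fin d) (u : ι → SmoothFn d) : fAnn i (gluonState e ν u) = 0 := by
  rw [gluonState_apply, fAnn_ccbar hc hcbar, fAnn_fCre_of_ne _ (hψ ν), fAnn_multiplet, map_zero,
    neg_zero, map_zero]

theorem fAnn_psi_gluonState (μ ν : Fin d) (u : ι → SmoothFn d) :
    fAnn (.ψ μ 0) (gluonState e ν u) = if μ = ν then ccbar 𝔤 d (multiplet e u) else 0 := by
  rw [gluonState_apply, fAnn_ccbar (by simp) (by simp)]
  split_ifs with h
  · rw [h, fAnn_fCre_self, fAnn_multiplet, map_zero, sub_zero]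
  · rw [fAnn_fCre_of_ne _ (by simpa using h), fAnn_multiplet, map_zero, neg_zero, map_zero]

theorem isVertexState_gluonState (ν : Fin d) (u : ι → SmoothFn d) :
    IsVertexState (gluonState e ν u) where
  bAnn i := by
    rw [gluonState_apply, apply_ccbar_fCre (T := bAnn i) (fun _ => commute_onBos_onFer ..),
      bAnn_multiplet, map_zero, map_zero]
  opJ x n := by
    rw [gluonState_apply, opJ_ccbar_fCre, opJ_natCast_add_one_multiplet, map_zero, map_zero]
  fAnn i hψ hc hcbar := fAnn_gluonState e hψ hc hcbar ν u
  fAnn_fAnn μ ρ := by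
    rw [fAnn_psi_gluonState]
    split_ifs
    · rw [fAnn_ccbar (by simp) (by simp), fAnn_multiplet, map_zero]
    · exact map_zero _
  fCre_c := fCre_c_ccbar _
  fCre_cbar := fCre_cbar_ccbar _

variable (A a : Fin d → ι → SmoothFn d)

theorem isVertexState_gluonV : IsVertexState (gluonV e a) := by
  change gluonV e a ∈ vertexSpace 𝔤 d
  rw [gluonV_eq]
  exact sum_mem fun ν _ => isVertexState_gluonState e ν (a ν)

theorem fAnn_psi_gluonV (μ : Fin d) :
    fAnn (.ψ μ 0) (gluonV e a) = ccbar 𝔤 d (multiplet e (a μ)) := by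
  simp only [gluonV_eq, map_sum, fAnn_psi_gluonState, Finset.sum_ite_eq, Finset.mem_univ, if_true]

theorem fCre_fAnn_psi_gluonV (μ ν : Fin d) :
    fCre (.ψ μ 0) (fAnn (.ψ ν 0) (gluonV e a)) = gluonState e μ (a ν) := by
  rw [fAnn_psi_gluonV, fCre_ccbar]
  rfl

theorem commute_adOp_fCre (F : ι → SmoothFn d) (i : FMode d) : Commute (adOp e F) (fCre i) := by
  refine Commute.sum_left _ _ _ fun a _ => ?_
  have comm_mulFn : Commute (mulFn (F a) : Module.End ℂ (State 𝔤 d)) (fCre i) :=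
    commute_onFn_onFer ..
  have comm_opJ : Commute (opJ (e a) 0 : Module.End ℂ (State 𝔤 d)) (fCre i) :=
    (commute_onFer_onCur ..).symm
  exact comm_mulFn.mul_left comm_opJ

theorem commute_covOp_fCre (μ : Fin d) (i : FMode d) : Commute (covOp e A μ) (fCre i) :=
  (commute_onFn_onFer ..).add_left (commute_adOp_fCre ..)

section Cyclic

variable {e} (hcyc : ∀ a b c, structConst e a b c = structConst e b c a)

include hcyc

theorem adOp_gluonState (F u : ι → SmoothFn d) (ν : Fin d) :
    adOp e F (gluonState e ν u) = gluonState e ν (adMul e F u) := by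
  rw [gluonState_apply, apply_ccbar_fCre (commute_adOp_fCre e F), adOp_multiplet hcyc]
  rfl

theorem covOp_gluonState (μ ν : Fin d) (u : ι → SmoothFn d) :
    covOp e A μ (gluonState e ν u) = gluonState e ν (covD e A μ u) := by
  rw [gluonState_apply, apply_ccbar_fCre (commute_covOp_fCre e A μ), covOp_multiplet hcyc]
  rfl

theorem covOp_ccbar_multiplet (μ : Fin d) (u : ι → SmoothFn d) :
    covOp e A μ (ccbar 𝔤 d (multiplet e u)) = ccbar 𝔤 d (multiplet e (covD e A μ u)) := by
  rw [← covOp_multiplet hcyc]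
  exact LinearMap.congr_fun
    ((commute_covOp_fCre e A μ _).mul_right (commute_covOp_fCre e A μ _)).eq _

theorem curG_one_gluonV :
    curG e A 1 (gluonV e a) = -ccbar 𝔤 d (multiplet e (lorenz e A a)) := by
  rw [(hasTopMode_curG e A).eq_top _ (isVertexState_gluonV e a), LinearMap.sum_apply, lorenz,
    map_sum, map_sum, ← Finset.sum_neg_distrib]
  refine Finset.sum_congr rfl fun μ _ => ?_
  rw [Module.End.mul_apply, LinearMap.neg_apply, LinearMap.smul_apply, fAnn_psi_gluonV, map_smul,
    map_smul, map_smul, covOp_ccbar_multiplet A hcyc]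

theorem curH_one_gluonV : curH e A 1 (gluonV e a) = gluonV e (linYM e A a) := by
  have laplacian : ∑ μ, eta μ • covOp e A μ (covOp e A μ (gluonV e a)) =
      ∑ ν, gluonState e ν (∑ μ, eta μ • covD e A μ (covD e A μ (a ν))) := by
    simp only [gluonV_eq, map_sum, map_smul, covOp_gluonState A hcyc, Finset.smul_sum]
    exact Finset.sum_comm
  have spin (μ ν : Fin d) : adOp e (fieldStrength e A μ ν)
        (eta ν • gluonState e μ (a ν) - eta μ • gluonState e ν (a μ)) =
      gluonState e μ (eta ν • adMul e (a ν) (fieldStrength e A ν μ)) +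
        gluonState e ν (eta μ • adMul e (a μ) (fieldStrength e A μ ν)) := by
    rw [map_sub, map_smul, map_smul, adOp_gluonState hcyc, adOp_gluonState hcyc,
      adMul_fieldStrength hcyc,
      adMul_antisymm hcyc (fieldStrength e A μ ν), map_neg, smul_neg, sub_neg_eq_add, map_smul,
      map_smul]
  rw [(hasTopMode_curH e A).eq_top _ (isVertexState_gluonV e a), gluonV_eq e (linYM e A a)]
  simp only [LinearMap.add_apply, LinearMap.sum_apply, LinearMap.smul_apply, LinearMap.sub_apply,
    Module.End.mul_apply, fCre_fAnn_psi_gluonV, laplacian, spin, Finset.sum_add_distrib, linYM_eq,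
    map_add, map_smul, map_sum, two_smul]
  congr 2
  exact Finset.sum_comm

theorem stressT_one_gluonV [DecidableEq ι] {C : ℝ} (hC : C ≠ 0)
    (hsum : ∀ a b, ∑ c, ∑ k, structConst e a c k * structConst e b c k =
      if a = b then (C : ℂ) else 0) :
    stressT e C 1 (gluonV e a) = gluonV e a := by
  have fermion_number : ∑ μ, fCre (.ψ μ 0) (fAnn (.ψ μ 0) (gluonV e a)) = gluonV e a := by
    simp only [fCre_fAnn_psi_gluonV, ← gluonV_eq]
  have casimir (ν : Fin d) : ∑ b, opJ (e b) 0 (opJ (e b) 0 (gluonState e ν (a ν))) =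
      -(C : ℂ) • gluonState e ν (a ν) := by
    simp only [gluonState_apply, opJ_ccbar_fCre, ← map_sum, casimir_multiplet hcyc hsum, map_smul]
  have casimir_gluonV :
      ∑ b, opJ (e b) 0 (opJ (e b) 0 (gluonV e a)) = -(C : ℂ) • gluonV e a := by
    simp only [gluonV_eq, map_sum, Finset.smul_sum, ← casimir]
    exact Finset.sum_comm
  rw [(hasTopMode_stressT e C).eq_top _ (isVertexState_gluonV e a)]
  simp only [LinearMap.sub_apply, LinearMap.smul_apply, LinearMap.sum_apply,
    Module.End.mul_apply, Module.End.one_apply, fermion_number, casimir_gluonV, smul_smul, mul_neg,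
    inv_mul_cancel₀ (Complex.ofReal_ne_zero.mpr hC)]
  module

end Cyclic

end GluonVertex

section BRST

variable {𝔤 : Type*} [LieRing 𝔤] [LieAlgebra ℝ 𝔤] {d : ℕ} {v : State 𝔤 d}

theorem HasTopMode.nop_zero_of_filled {S : Submodule ℂ (State 𝔤 d)} {Φ Ψ : WField 𝔤 d}
    {T : Module.End ℂ (State 𝔤 d)} (hΦ : HasTopMode S Φ (-1) 0) (hΨ : HasTopMode S Ψ 1 T)
    (hv : v ∈ S) (filled : Φ (-1) (Ψ 0 v) = 0) : nop Φ Ψ 0 v = Φ (-2) (Ψ 1 v) := by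
  have apply_nonneg (m : ℤ) (hm : m ≥ 0) : Φ m v = 0 := hΦ.eq_zero m (by omega) v hv
  rw [nop, nopSign_eq_add_add, filled, apply_nonneg 0 le_rfl, hΨ.stable_bot.map_zero, smul_zero,
    add_zero, add_zero, zero_add]
  · intro m hm
    rw [hΨ.eq_zero _ (by omega) v hv, hΦ.stable_bot.map_zero]
  · intro m hm
    rw [apply_nonneg m hm.le, hΨ.stable_bot.map_zero]

theorem nop_fB_nopF_fC_del_fC (hv : IsVertexState v) :
    nop fB (nopF fC (del fC)) 0 v = -fC (-2) v := by
  have c : IsFilledGhost (vertexSpace 𝔤 d) fC fB := isFilledGhost_fC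
  have c_del_c : HasTopMode (vertexSpace 𝔤 d) (nopF fC (del fC)) 0 0 :=
    (c.hasTopMode.nopSign_of_top_neg_one (-1) c.hasTopMode.del).congr (zero_mul _)
  have del_c_b (k : ℤ) (hk : k > -1) : del fC k (fB 0 v) = 0 := by
    obtain rfl | hk : k = 0 ∨ 0 < k := by omega
    · rw [del, Int.cast_zero, neg_zero, zero_smul]
    · rw [del, c.apply_eq_zero _ (by omega) v hv, smul_zero]
  have b_c_del_c : nop fB (nopF fC (del fC)) 0 v = nopF fC (del fC) (-1) (fB 0 v) := by
    rw [nop, nopSign_eq_add _ c.stable_bot c_del_c.stable_bot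
      (fun k hk => c_del_c.eq_zero k hk v hv)
      fun m hm => c.eq_zero m hm v hv, c_del_c.eq_top v hv, LinearMap.zero_apply,
      c.stable_bot.map_zero, zero_add, one_smul, zero_sub]
  have c_del_c_b : nopF fC (del fC) (-1) (fB 0 v) = fC (-1) (fC (-2) (fB 0 v)) := by
    rw [nopF, nopSign_eq_add _ c.hasTopMode.stable_bot c.hasTopMode.stable_bot.del del_c_b
      fun m hm => c.apply_eq_zero m hm.le v hv, c.apply_eq_zero 0 le_rfl v hv,
      c.hasTopMode.stable_bot.del.map_zero, smul_zero, add_zero, del]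
    simp
  have refill : fC (-1) (fB 0 v) = v := by simpa only [one_smul] using c.refill 1 v hv
  have anticomm : fC (-1) (fC (-2) (fB 0 v)) = -fC (-2) (fC (-1) (fB 0 v)) :=
    fCre_fCre (fB 0 v) (.c 0) (.c 1)
  rw [b_c_del_c, c_del_c_b, anticomm, refill]

theorem nop_fBbar_nop_fGamma_fGamma (hv : IsVertexState v) :
    nop fBbar (nop fGamma fGamma) 0 v = 0 := by
  have gamma : HasTopMode (⨅ k, LinearMap.ker (bAnn (𝔤 := 𝔤) (d := d) (.β k))) fGamma (-1) 0 :=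
    hasTopMode_fGamma fun _ h k => (Submodule.mem_iInf _).mp h k
  have gamma_gamma := gamma.nop_of_top_neg_one gamma
  have v_mem : v ∈ ⨅ k, LinearMap.ker (bAnn (.β k)) :=
    (Submodule.mem_iInf _).mpr fun k => hv.bAnn _
  have bbar_mem : fBbar 0 v ∈ ⨅ k, LinearMap.ker (bAnn (.β k)) :=
    (Submodule.mem_iInf _).mpr fun k =>
      map_mem_ker_of_commute (commute_onBos_onFer _ _) (hv.bAnn (.β k))
  have bbar := isFilledGhost_fCbar (𝔤 := 𝔤) (d := d)
  rw [nop, nopSign_eq_add _ bbar.stable_bot gamma_gamma.stable_bot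
    (fun k hk => gamma_gamma.eq_zero k (by omega) v v_mem) fun m hm => bbar.eq_zero m hm v hv,
    gamma_gamma.eq_zero 0 (by decide) v v_mem, bbar.stable_bot.map_zero, zero_add, zero_sub,
    gamma_gamma.eq_top _ bbar_mem, zero_mul, LinearMap.zero_apply, smul_zero]

variable {ι : Type*} [Fintype ι] (e : Module.Basis ι ℝ 𝔤)

theorem brstQ_apply (hv : IsVertexState v) (C : ℝ) (A : Fin d → ι → SmoothFn d) :
    brstQ e C A v = fC (-2) (stressT e C 1 v) - fC (-2) v + fGamma (-2) (curG e A 1 v)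
      + fCbar (-2) (curH e A 1 v) := by
  have c_T : nop fC (stressT e C) 0 v = fC (-2) (stressT e C 1 v) :=
    isFilledGhost_fC.hasTopMode.nop_zero_of_filled (hasTopMode_stressT e C) hv <|
      (modeStable_ker_fCre (.c 0)).stressT e (by simp) (by simp) (by simp) C 0 v hv.fCre_c
  have γ_G : nop fGamma (curG e A) 0 v = fGamma (-2) (curG e A 1 v) :=
    isFilledGhost_fGamma.hasTopMode.nop_zero_of_filled (hasTopMode_curG e A) hv <|
      (modeStable_ker_bAnn (.β 0)).curG e (by simp) (by simp) (by simp) A 0 v (hv.bAnn _)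
  have cbar_H : nop fCbar (curH e A) 0 v = fCbar (-2) (curH e A 1 v) :=
    isFilledGhost_fCbar.hasTopMode.nop_zero_of_filled (hasTopMode_curH e A) hv <|
      (modeStable_ker_fCre (.cbar 0)).curH e (by simp) (by simp) (by simp) A 0 v hv.fCre_cbar
  simp only [brstQ, Pi.add_apply, Pi.sub_apply, Pi.smul_apply, c_T, γ_G, cbar_H,
    nop_fB_nopF_fC_del_fC hv, nop_fBbar_nop_fGamma_fGamma hv, smul_zero, sub_zero,
    ← sub_eq_add_neg]

theorem fGamma_neg_two_ccbar (v : State 𝔤 d) :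
    fGamma (-2) (ccbar 𝔤 d v) = ccbar 𝔤 d (bCre (.γ 0) v) := by
  have comm (i : FMode d) : Commute (bCre (.γ 0) : Module.End ℂ (State 𝔤 d)) (fCre i) :=
    commute_onBos_onFer ..
  exact LinearMap.congr_fun ((comm _).mul_right (comm _)).eq v

theorem fCbar_neg_two_gluonV (a : Fin d → ι → SmoothFn d) :
    fCbar (-2) (gluonV e a) =
      ccbar 𝔤 d (∑ ν, fCre (.cbar 1) (fCre (.ψ ν 0) (multiplet e (a ν)))) := by
  simp only [gluonV_eq, gluonState_apply, map_sum, ← fCre_ccbar (.cbar 1)]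
  exact map_sum (fCre (.cbar 1)) _ _

/-- The state `c c̄ δ(γ) j^a (∂c̄ ψ^ν y_ν^a - ∂γ u^a)`. -/
def gluonImage (y : Fin d → ι → SmoothFn d) (u : ι → SmoothFn d) : State 𝔤 d :=
  ccbar 𝔤 d (∑ ν, fCre (.cbar 1) (fCre (.ψ ν 0) (multiplet e (y ν)))
    - bCre (.γ 0) (multiplet e u))

theorem gluonImage_eq_sum (y : Fin d → ι → SmoothFn d) (u : ι → SmoothFn d) :
    gluonImage e y u = ∑ i, fC (-1) (fCbar (-1)
      ((∑ ν, fCbar (-2) (fPsi ν (-1) (fJ (e i) (-1) (fnState 𝔤 (y ν i)))))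
        - fGamma (-2) (fJ (e i) (-1) (fnState 𝔤 (u i))))) := by
  simp only [gluonImage, multiplet_apply, map_sum]
  rw [Finset.sum_comm (s := Finset.univ (α := Fin d)), ← Finset.sum_sub_distrib, map_sum]
  rfl

variable {e}

theorem brstQ_gluonV [DecidableEq ι] (hcyc : ∀ a b c, structConst e a b c = structConst e b c a)
    {C : ℝ} (hC : C ≠ 0)
    (hsum : ∀ a b, ∑ c, ∑ k, structConst e a c k * structConst e b c k =
      if a = b then (C : ℂ) else 0) (A a : Fin d → ι → SmoothFn d) :
    brstQ e C A (gluonV e a) = gluonImage e (linYM e A a) (lorenz e A a) := by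
  rw [brstQ_apply e (isVertexState_gluonV e a), stressT_one_gluonV a hcyc hC hsum, sub_self,
    zero_add, curG_one_gluonV A a hcyc, curH_one_gluonV A a hcyc, fCbar_neg_two_gluonV, ← map_neg,
    fGamma_neg_two_ccbar, ← map_add, map_neg, neg_add_eq_sub, gluonImage]

end BRST

section Injectivity

variable {𝔤 ι : Type*} [LieRing 𝔤] [LieAlgebra ℝ 𝔤] [Fintype ι] {e : Module.Basis ι ℝ 𝔤} {d : ℕ}

theorem bAnn_fCre (i : BMode d) (j : FMode d) (v : State 𝔤 d) :
    bAnn i (fCre j v) = fCre j (bAnn i v) :=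
  LinearMap.congr_fun (commute_onBos_onFer _ _).eq v

theorem fAnn_bCre (i : BMode d) (j : FMode d) (v : State 𝔤 d) :
    fAnn j (bCre i v) = bCre i (fAnn j v) :=
  (LinearMap.congr_fun (commute_onBos_onFer _ _).eq v).symm

theorem ccbar_eq_zero_iff {v : State 𝔤 d} (hc : fAnn (.c 0) v = 0) (hcbar : fAnn (.cbar 0) v = 0) :
    ccbar 𝔤 d v = 0 ↔ v = 0 := by
  refine ⟨fun h => ?_, fun h => by rw [h, map_zero]⟩
  have annihilate : fAnn (.cbar 0) (fAnn (.c 0) (ccbar 𝔤 d v)) = v := by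
    simp only [ccbar, Module.End.mul_apply, fAnn_fCre_self, hc, hcbar,
      fAnn_fCre_of_ne _ (show FMode.c 0 ≠ .cbar 0 by simp), map_zero, neg_zero, sub_zero]
  rw [← annihilate, h, map_zero, map_zero]

/-- The coefficient function of a state with respect to a functional `φ` on the current algebra
module and the vacua of the other fields. -/
def coeffFn (φ : Cur 𝔤 →ₗ[ℂ] ℂ) : State 𝔤 d →ₗ[ℂ] SmoothFn d :=
  (TensorProduct.rid ℂ (SmoothFn d)).toLinearMap ∘ₗ LinearMap.lTensor (SmoothFn d)
    (LinearMap.mul' ℂ ℂ ∘ₗ TensorProduct.map (MvPolynomial.aeval (0 : BMode d → ℂ)).toLinearMap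
      (LinearMap.mul' ℂ ℂ ∘ₗ TensorProduct.map
        (ExteriorAlgebra.algebraMapInv (R := ℂ) (M := FMode d →₀ ℂ)).toLinearMap φ))

theorem coeffFn_opJ_fnState (φ : Cur 𝔤 →ₗ[ℂ] ℂ) (x : 𝔤) (f : SmoothFn d) :
    coeffFn φ (opJ x (-1) (fnState 𝔤 f)) = φ (currentState x) • f := by
  rw [opJ, fnState, onCur_tmul, Algebra.lsmul_coe]
  simp only [coeffFn, LinearMap.comp_apply, LinearMap.lTensor_tmul, TensorProduct.map_tmul,
    LinearMap.mul'_apply, AlgHom.toLinearMap_apply, map_one, one_mul, LinearEquiv.coe_coe,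
    TensorProduct.rid_tmul, currentState]

theorem multiplet_injective (h : LinearIndependent ℂ fun a => currentState (e a)) :
    Function.Injective (multiplet e (d := d)) := by
  obtain ⟨coords, hcoords⟩ :=
    (Finsupp.linearCombination ℂ fun a => currentState (e a)).exists_leftInverse_of_injective
      (LinearMap.ker_eq_bot.mpr h)
  have coord_currentState (a b : ι) :
      (Finsupp.lapply a ∘ₗ coords) (currentState (e b)) = Finsupp.single b (1 : ℂ) a := by
    have := LinearMap.congr_fun hcoords (Finsupp.single b 1)
    rw [LinearMap.comp_apply, Finsupp.linearCombination_single, one_smul] at this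
    exact DFunLike.congr_fun this a
  rw [← LinearMap.ker_eq_bot, LinearMap.ker_eq_bot']
  classical
  intro u hu
  funext a
  rw [Pi.zero_apply]
  simpa only [multiplet_apply, map_sum, coeffFn_opJ_fnState, coord_currentState, map_zero,
    Finsupp.single_apply, ite_smul, one_smul, zero_smul, Finset.sum_ite_eq', Finset.mem_univ,
    if_true] using congrArg (coeffFn (Finsupp.lapply a ∘ₗ coords)) hu

variable [DecidableEq ι]

attribute [local instance 100] LieRing.ofAssociativeRing

variable (e) in
/-- The adjoint representation of the complexification of `𝔤` in matrices. -/
def adMat : ℂ ⊗[ℝ] 𝔤 →ₗ⁅ℂ⁆ Matrix ι ι ℂ :=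
  (LinearMap.toMatrixAlgEquiv (e.baseChange ℂ)).toAlgHom.toLieHom.comp (LieAlgebra.ad ℂ _)

theorem adMat_basis (a b c : ι) : adMat e (1 ⊗ₜ e a) b c = structConst e a c b := by
  simp [adMat, LinearMap.toMatrixAlgEquiv_apply, LieAlgebra.ExtendScalars.bracket_tmul, structConst]

section SumStructConst

variable {C : ℂ} (hC : C ≠ 0)
  (hsum : ∀ a b, ∑ c, ∑ k, structConst e a c k * structConst e b c k = if a = b then C else 0)

include hC hsum

theorem linearIndependent_adMat : LinearIndependent ℂ fun a => adMat e (1 ⊗ₜ e a) := by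
  rw [Fintype.linearIndependent_iff]
  intro s hs a
  have entry (c k : ι) : ∑ b, s b * structConst e b c k = 0 := by
    simpa only [Matrix.sum_apply, Matrix.smul_apply, adMat_basis, smul_eq_mul, Matrix.zero_apply]
      using congrFun (congrFun hs k) c
  have contraction : C * s a = 0 :=
    calc C * s a = ∑ b, (∑ c, ∑ k, structConst e a c k * structConst e b c k) * s b := by
          simp only [hsum, ite_mul, zero_mul, Finset.sum_ite_eq, Finset.mem_univ, if_true]
      _ = ∑ c, ∑ k, structConst e a c k * ∑ b, s b * structConst e b c k := by
          simp only [Finset.sum_mul, Finset.mul_sum]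
          rw [Finset.sum_comm]
          refine Finset.sum_congr rfl fun c _ => ?_
          rw [Finset.sum_comm]
          exact Finset.sum_congr rfl fun k _ => Finset.sum_congr rfl fun b _ => by ring
      _ = 0 := by simp only [entry, mul_zero, Finset.sum_const_zero]
  exact (mul_eq_zero.mp contraction).resolve_left hC

theorem multiplet_eq_zero_iff (u : ι → SmoothFn d) : multiplet e u = 0 ↔ u = 0 :=
  map_eq_zero_iff _ <| multiplet_injective <|
    linearIndependent_currentState (adMat e) (linearIndependent_adMat hC hsum)

theorem gluonImage_eq_zero_iff (y : Fin d → ι → SmoothFn d) (u : ι → SmoothFn d) :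
    gluonImage e y u = 0 ↔ u = 0 ∧ y = 0 := by
  have y_part (ν : Fin d) : fAnn (.ψ ν 0) (fAnn (.cbar 1)
      (∑ μ, fCre (.cbar 1) (fCre (.ψ μ 0) (multiplet e (y μ))) - bCre (.γ 0) (multiplet e u))) =
      multiplet e (y ν) := by
    have contract (μ : Fin d) : fAnn (.ψ ν 0) (fCre (.ψ μ 0) (multiplet e (y μ))) =
        if ν = μ then multiplet e (y ν) else 0 := by
      split_ifs with h
      · rw [h, fAnn_fCre_self, fAnn_multiplet, map_zero, sub_zero]
      · rw [fAnn_fCre_of_ne _ (by simpa using h), fAnn_multiplet, map_zero, neg_zero]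
    simp only [map_sub, map_sum, fAnn_fCre_self, fAnn_bCre, fAnn_multiplet, map_zero, sub_zero,
      fAnn_fCre_of_ne _ (show FMode.cbar 1 ≠ .ψ _ 0 by simp), neg_zero, contract,
      Finset.sum_ite_eq, Finset.mem_univ, if_true]
  have u_part : bAnn (.γ 0)
      (∑ μ, fCre (.cbar 1) (fCre (.ψ μ 0) (multiplet e (y μ))) - bCre (.γ 0) (multiplet e u)) =
      -multiplet e u := by
    simp only [map_sub, map_sum, bAnn_fCre, bAnn_bCre_self, bAnn_multiplet, map_zero,
      Finset.sum_const_zero, add_zero, zero_sub]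
  have annihilated {i : FMode d} (hcbar : i ≠ .cbar 1) (hψ : ∀ ν, i ≠ .ψ ν 0) : fAnn i
      (∑ μ, fCre (.cbar 1) (fCre (.ψ μ 0) (multiplet e (y μ))) - bCre (.γ 0) (multiplet e u)) =
      0 := by
    simp only [map_sub, map_sum, fAnn_fCre_of_ne _ hcbar, fAnn_fCre_of_ne _ (hψ _), fAnn_bCre,
      fAnn_multiplet, map_zero, neg_zero, Finset.sum_const_zero, sub_zero]
  rw [gluonImage, ccbar_eq_zero_iff (annihilated (by simp) (by simp))
    (annihilated (by simp) (by simp))]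
  constructor
  · intro h
    rw [h, map_zero] at u_part
    simp only [h, map_zero] at y_part
    exact ⟨(multiplet_eq_zero_iff hC hsum u).mp (neg_eq_zero.mp u_part.symm),
      funext fun ν => (multiplet_eq_zero_iff hC hsum (y ν)).mp (y_part ν).symm⟩
  · rintro ⟨rfl, rfl⟩
    simp

end SumStructConst

end Injectivity

end Ambitwistor

end

theorem mainTheorem3_general {𝔤 ι : Type*} [LieRing 𝔤] [LieAlgebra ℝ 𝔤] [Fintype ι]
    [DecidableEq ι] (e : Module.Basis ι ℝ 𝔤) (C : ℝ) (hC : C ≠ 0)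
    (he : ∀ a b, killingForm ℝ 𝔤 (e a) (e b) = if a = b then -C else 0)
    (d : ℕ) (A a : Fin d → ι → Ambitwistor.SmoothFn d) :
    Ambitwistor.brstQ e C A (Ambitwistor.gluonV e a) =
        ∑ i, Ambitwistor.fC (-1) (Ambitwistor.fCbar (-1)
          ((∑ ν, Ambitwistor.fCbar (-2) (Ambitwistor.fPsi ν (-1) (Ambitwistor.fJ (e i) (-1)
              (Ambitwistor.fnState 𝔤 (Ambitwistor.linYM e A a ν i)))))
            - Ambitwistor.fGamma (-2) (Ambitwistor.fJ (e i) (-1)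
              (Ambitwistor.fnState 𝔤 (Ambitwistor.lorenz e A a i))))) ∧
      (Ambitwistor.brstQ e C A (Ambitwistor.gluonV e a) = 0 ↔
        (∀ i, Ambitwistor.lorenz e A a i = 0) ∧
          ∀ ν i, Ambitwistor.linYM e A a ν i = 0) := by
  have hsum := Ambitwistor.sum_structConst_mul hC he
  have image_eq :=
    Ambitwistor.brstQ_gluonV (Ambitwistor.structConst_cyclic hC he) hC hsum A a
  refine ⟨image_eq.trans (Ambitwistor.gluonImage_eq_sum ..), ?_⟩
  rw [image_eq, Ambitwistor.gluonImage_eq_zero_iff (Complex.ofReal_ne_zero.mpr hC) hsum]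
  simp only [funext_iff, Pi.zero_apply]

theorem mainTheorem3 {𝔤 ι : Type*} [LieRing 𝔤] [LieAlgebra ℝ 𝔤] [LieAlgebra.IsSimple ℝ 𝔤]
    [Fintype ι] [DecidableEq ι] (e : Module.Basis ι ℝ 𝔤) (C : ℝ) (hC : 0 < C)
    (he : ∀ a b, killingForm ℝ 𝔤 (e a) (e b) = if a = b then -C else 0)
    (d : ℕ) (A a : Fin d → ι → Ambitwistor.SmoothFn d) :
    Ambitwistor.brstQ e C A (Ambitwistor.gluonV e a) =
        ∑ i, Ambitwistor.fC (-1) (Ambitwistor.fCbar (-1)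
          ((∑ ν, Ambitwistor.fCbar (-2) (Ambitwistor.fPsi ν (-1) (Ambitwistor.fJ (e i) (-1)
              (Ambitwistor.fnState 𝔤 (Ambitwistor.linYM e A a ν i)))))
            - Ambitwistor.fGamma (-2) (Ambitwistor.fJ (e i) (-1)
              (Ambitwistor.fnState 𝔤 (Ambitwistor.lorenz e A a i))))) ∧
      (Ambitwistor.brstQ e C A (Ambitwistor.gluonV e a) = 0 ↔
        (∀ i, Ambitwistor.lorenz e A a i = 0) ∧
          ∀ ν i, Ambitwistor.linYM e A a ν i = 0) :=
  mainTheorem3_general e C hC.ne' he d A a
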